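/- Let $\bar{\mathbb R}=\mathbb R\cup\{\infty\}$ be the one-point compactification of the real line. Put $r\oplus s=\{r+s\}$ for $r,s\in\mathbb R$, $r\oplus\infty=\infty\oplus r=\{\infty\}$ for $r\in\mathbb R$, and $\infty\oplus\infty=\bar{\mathbb R}$; put $r\odot s=\{rs\}$ for $r,s\in\mathbb R$, $r\odot\infty=\infty\odot r=\{\infty\}$ for $r\in\bar{\mathbb R}\setminus\{0\}$, and $0\odot\infty=\infty\odot0=\bar{\mathbb R}$. An $\mathbb R$-place on a field $K$ is a function $\chi:K\to\bar{\mathbb R}$ with $\chi(0)=0$, $\chi(1)=1$, $\chi(x+y)\in\chi(x)\oplus\chi(y)$ and $\chi(xy)\in\chi(x)\odot\chi(y)$ for all $x,y\in K$. The set $M(K)$ of all $\mathbb R$-places on $K$ carries the subspace topology from the product $\bar{\mathbb R}^K$. Let $n\ge 0$ and $\vec x=(x_1,\dots,x_n)$. Write $f\in\mathbb R(\vec x)$ as an irreducible fraction $f=p/q$ of polynomials. Then $f$ is regarded as the continuous function $f:\mathrm{dom}(f)\to\bar{\mathbb R}$ on $\mathrm{dom}(f)=\mathbb R^n\setminus(p^{-1}(0)\cap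 q^{-1}(0))\subset\bar{\mathbb R}^n$ equal to $p(z)/q(z)$ if $q(z)\neq0$ and to $\infty$ if $q(z)=0$. Let $\bar\Gamma(f)$ be the closure of the graph of $f$ in $\bar{\mathbb R}^n\times\bar{\mathbb R}$ and let $\bar f(\vec a)=\{y\in\bar{\mathbb R}:(\vec a,y)\in\bar\Gamma(f)\}$ for $\vec a\in\bar{\mathbb R}^n$. For a finite set $\mathcal E\subset\mathbb R(\vec x)$ let $\bar\Gamma(\mathcal E)$ be the closure in $\bar{\mathbb R}^n\times\bar{\mathbb R}^{\mathcal E}$ of the graph of $z\mapsto(f(z))_{f\in\mathcal E}$, defined on $\bigcap_{f\in\mathcal E}\mathrm{dom}(f)$. For an arbitrary $\mathcal F\subset\mathbb R(\vec x)$ let the graphoid $\bar\Gamma(\mathcal F)\subset\bar{\mathbb R}^n\times\bar{\mathbb R}^{\mathcal F}$ be the subspace of all points $(\vec a,(y_f)_{f\in\mathcal F})$ such that $(\vec a,(y_f)_{f\in\mathcal E})\in\bar\Gamma(\mathcal E)$ for every finite $\mathcal E\subset\mathcal F$. **Theorem.** Let $\mathcal F\supset\mathbb Q(\vec x)$ be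 a subfield of $\mathbb R(\vec x)$. 1. For each point $\gamma=(\vec a,(y_f)_{f\in\mathcal F})$ of the graphoid $\bar\Gamma(\mathcal F)$, the function $\delta_\gamma:\mathcal F\to\bar{\mathbb R}$, $\delta_\gamma(f)=y_f$, is an $\mathbb R$-place on $\mathcal F$, and $\delta_\gamma(f)\in\bar f(\vec a)$ for every $f\in\mathcal F$. 2. The map $\delta:\bar\Gamma(\mathcal F)\to M(\mathcal F)$, $\gamma\mapsto\delta_\gamma$, is a topological embedding. 3. If $\mathcal F=\mathbb K(\vec x)$ for some subfield $\mathbb K\subset\mathbb R$, then $\delta(\bar\Gamma(\mathcal F))=\{\chi\in M(\mathcal F):\chi(c)=c\text{ for all }c\in\mathbb K\}$. -/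

import Mathlib

open Topology

noncomputable section

/-- The extended real line `ℝ ∪ {∞}`: the one-point compactification of the real line. -/
abbrev ExtReal : Type := OnePoint ℝ

namespace ExtReal

/-- The multivalued addition `r ⊕ s` on `ℝ ∪ {∞}`: single-valued except that `∞ ⊕ ∞` is the whole
extended line. -/
def mAdd : ExtReal → ExtReal → Set ExtReal
  | OnePoint.some r, OnePoint.some s => {((r + s : ℝ) : ExtReal)}
  | OnePoint.some _, OnePoint.infty => {OnePoint.infty}
  | OnePoint.infty, OnePoint.some _ => {OnePoint.infty}
  | OnePoint.infty, OnePoint.infty => Set.univ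

/-- The multivalued multiplication `r ⊙ s` on `ℝ ∪ {∞}`: single-valued except that `0 ⊙ ∞` and
`∞ ⊙ 0` are the whole extended line. -/
def mMul : ExtReal → ExtReal → Set ExtReal
  | OnePoint.some r, OnePoint.some s => {((r * s : ℝ) : ExtReal)}
  | OnePoint.some r, OnePoint.infty => if r = 0 then Set.univ else {OnePoint.infty}
  | OnePoint.infty, OnePoint.some s => if s = 0 then Set.univ else {OnePoint.infty}
  | OnePoint.infty, OnePoint.infty => {OnePoint.infty}

/-- The real number underlying a finite point of the extended line (`0` at `∞`). -/
def toReal : ExtReal → ℝ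
  | OnePoint.some r => r
  | OnePoint.infty => 0

theorem continuousAt_toReal_coe (r : ℝ) : ContinuousAt toReal (r : ExtReal) := by
  rw [OnePoint.continuousAt_coe]
  exact continuousAt_id

end ExtReal

/-- `χ` is an `ℝ`-place on the field `K`. -/
structure IsRPlace {K : Type*} [Field K] (χ : K → ExtReal) : Prop where
  map_zero : χ 0 = ((0 : ℝ) : ExtReal)
  map_one : χ 1 = ((1 : ℝ) : ExtReal)
  map_add : ∀ x y, χ (x + y) ∈ ExtReal.mAdd (χ x) (χ y)
  map_mul : ∀ x y, χ (x * y) ∈ ExtReal.mMul (χ x) (χ y)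

/-- The space `M(K)` of `ℝ`-places on `K`, with the topology of a subspace of the Tychonoff product
`ExtReal ^ K`. -/
abbrev RPlaceSpace (K : Type*) [Field K] : Type _ := {χ : K → ExtReal // IsRPlace χ}

/-- A partial function between topological spaces: a continuous function to `Y` defined on a
subspace `dom` of `X`. The values of `toFun` outside `dom` are irrelevant. -/
structure PartialFn (X Y : Type*) [TopologicalSpace X] [TopologicalSpace Y] where
  dom : Set X
  toFun : X → Y
  continuousOn : ContinuousOn toFun dom

section Graphoid

variable {X Y : Type*} [TopologicalSpace X] [TopologicalSpace Y]

/-- The graphoid of a single partial function: the closure of its graph. -/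
def PartialFn.graphoid (f : PartialFn X Y) : Set (X × Y) :=
  closure {z | ∃ x ∈ f.dom, z = (x, f.toFun x)}

/-- The multivalued extension of a partial function, whose graph is the graphoid. -/
def PartialFn.multiExt (f : PartialFn X Y) (x : X) : Set Y :=
  {y | (x, y) ∈ f.graphoid}

/-- The graphoid of a finite subfamily: the closure of the graph of the vector function
`x ↦ (f i x)` with `i ∈ E`, defined on the intersection of the domains. -/
def finiteGraphoid {ι : Type*} (f : ι → PartialFn X Y) (E : Finset ι) : Set (X × (E → Y)) :=
  closure {z | ∃ x, (∀ i ∈ E, x ∈ (f i).dom) ∧ z = (x, fun i : E => (f i).toFun x)}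

/-- The graphoid of an arbitrary family: the intersection of the preimages of the graphoids of its
finite subfamilies under the natural projections. -/
def familyGraphoid {ι : Type*} (f : ι → PartialFn X Y) : Set (X × (ι → Y)) :=
  {γ | ∀ E : Finset ι, (γ.1, fun i : E => γ.2 i) ∈ finiteGraphoid f E}

end Graphoid

/-- The field `ℝ(x₁, …, xₙ)` of rational functions of `n` variables. -/
abbrev RealRatFunc (n : ℕ) : Type := FractionRing (MvPolynomial (Fin n) ℝ)

namespace RealRatFunc

variable {n : ℕ}

/-- The constant function `c`. -/
def const (c : ℝ) : RealRatFunc n := algebraMap (MvPolynomial (Fin n) ℝ) _ (MvPolynomial.C c)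

/-- The variable `xᵢ`. -/
def var (i : Fin n) : RealRatFunc n := algebraMap (MvPolynomial (Fin n) ℝ) _ (MvPolynomial.X i)

/-- The numerator of `f` written as an irreducible fraction. -/
def num (f : RealRatFunc n) : MvPolynomial (Fin n) ℝ :=
  IsFractionRing.num (MvPolynomial (Fin n) ℝ) f

/-- The denominator of `f` written as an irreducible fraction. -/
def den (f : RealRatFunc n) : MvPolynomial (Fin n) ℝ :=
  (IsFractionRing.den (MvPolynomial (Fin n) ℝ) f : MvPolynomial (Fin n) ℝ)

open Classical in
/-- The value of `f` at a point of `ℝⁿ` where the numerator and denominator do not both vanish: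
the quotient if the denominator is nonzero, and `∞` otherwise. -/
def value (f : RealRatFunc n) (x : Fin n → ℝ) : ExtReal :=
  if MvPolynomial.eval x f.den = 0 then OnePoint.infty
  else ((MvPolynomial.eval x f.num / MvPolynomial.eval x f.den : ℝ) : ExtReal)

theorem continuousAt_value (f : RealRatFunc n) (x : Fin n → ℝ)
    (hx : ¬ (MvPolynomial.eval x f.num = 0 ∧ MvPolynomial.eval x f.den = 0)) :
    ContinuousAt f.value x := by
  have hp : ContinuousAt (fun z => MvPolynomial.eval z f.num) x :=
    (MvPolynomial.continuous_eval f.num).continuousAt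
  have hq : ContinuousAt (fun z => MvPolynomial.eval z f.den) x :=
    (MvPolynomial.continuous_eval f.den).continuousAt
  by_cases h : MvPolynomial.eval x f.den = 0
  · have hp0 : MvPolynomial.eval x f.num ≠ 0 := fun h' => hx ⟨h', h⟩
    have hval : f.value x = OnePoint.infty := by simp [value, h]
    rw [ContinuousAt, hval, OnePoint.hasBasis_nhds_infty.tendsto_right_iff]
    rintro s ⟨-, hs⟩
    obtain ⟨R, hR⟩ := hs.isBounded.exists_norm_le
    set p0 := MvPolynomial.eval x f.num
    have hp0' : 0 < ‖p0‖ := norm_pos_iff.2 hp0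
    have hev : ∀ᶠ z in 𝓝 x, |R| * ‖MvPolynomial.eval z f.den‖ < ‖MvPolynomial.eval z f.num‖ := by
      refine Filter.Tendsto.eventually_lt (hq.norm.const_mul |R|) hp.norm ?_
      simpa [h] using hp0
    filter_upwards [hev] with z hz
    unfold value
    split_ifs with h0
    · exact Or.inr rfl
    · refine Or.inl ⟨_, fun hmem => ?_, rfl⟩
      have h1 := (hR _ hmem).trans (le_abs_self R)
      rw [norm_div, div_le_iff₀ (norm_pos_iff.2 h0)] at h1
      linarith
  · have hev : (fun z => ((MvPolynomial.eval z f.num / MvPolynomial.eval z f.den : ℝ) : ExtReal))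
        =ᶠ[𝓝 x] f.value := by
      filter_upwards [hq.eventually_ne h] with z hz
      simp [value, hz]
    refine ContinuousAt.congr ?_ hev
    exact (OnePoint.continuous_coe.continuousAt).comp (hp.div hq h)

theorem continuousAt_value_toReal (f : RealRatFunc n) (x : Fin n → ℝ)
    (hx : ¬ (MvPolynomial.eval x f.num = 0 ∧ MvPolynomial.eval x f.den = 0)) :
    ContinuousAt (fun z : Fin n → ExtReal => f.value (fun i => (z i).toReal))
      (fun i => (x i : ExtReal)) := by
  have h1 : ContinuousAt (fun z : Fin n → ExtReal => fun i => (z i).toReal)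
      (fun i => (x i : ExtReal)) := by
    refine continuousAt_pi.2 fun i => ?_
    have h2 : Filter.Tendsto (fun z : Fin n → ExtReal => z i) (𝓝 fun i => (x i : ExtReal))
        (𝓝 (x i : ExtReal)) := (continuous_apply i).continuousAt
    exact Filter.Tendsto.comp (ExtReal.continuousAt_toReal_coe (x i)) h2
  have h3 : Filter.Tendsto f.value (𝓝 x) (𝓝 (f.value x)) := f.continuousAt_value x hx
  exact Filter.Tendsto.comp h3 h1

/-- A rational function `f = p / q` (irreducible fraction) as a partial function from the torus
`ExtReal ^ n` to `ExtReal`, with domain `ℝⁿ \ (p⁻¹(0) ∩ q⁻¹(0))`. -/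
def toPartialFn (f : RealRatFunc n) : PartialFn (Fin n → ExtReal) ExtReal where
  dom := {z | ∃ x : Fin n → ℝ, (z = fun i => (x i : ExtReal)) ∧
    ¬ (MvPolynomial.eval x f.num = 0 ∧ MvPolynomial.eval x f.den = 0)}
  toFun z := f.value (fun i => (z i).toReal)
  continuousOn := by
    rintro z ⟨x, rfl, hx⟩
    exact (f.continuousAt_value_toReal x hx).continuousWithinAt

/-- For a subfield `K` of `ℝ`, the subfield `K(x₁, …, xₙ)` of `ℝ(x₁, …, xₙ)`: it is generated by the
constants from `K` and the variables. -/
def overSubfield (n : ℕ) (K : Subfield ℝ) : Subfield (RealRatFunc n) :=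
  Subfield.closure ((const '' (K : Set ℝ)) ∪ Set.range var)

theorem const_mem_overSubfield {K : Subfield ℝ} {c : ℝ} (hc : c ∈ K) :
    (const c : RealRatFunc n) ∈ overSubfield n K :=
  Subfield.subset_closure (Or.inl ⟨c, hc, rfl⟩)

/-- The graphoid of a subfield `F` of `ℝ(x₁, …, xₙ)`, i.e. of the family of partial functions
consisting of all elements of `F`. -/
def graphoid (F : Subfield (RealRatFunc n)) : Set ((Fin n → ExtReal) × (F → ExtReal)) :=
  familyGraphoid fun f : F => toPartialFn (f : RealRatFunc n)

end RealRatFunc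

/-- The subfield `ℚ` of `ℝ`. -/
def ratSubfield : Subfield ℝ := (algebraMap ℚ ℝ).fieldRange

end

/-!
A point of the graphoid is, for each finite set of functions, a limit of values at points of `ℝⁿ`.
At such points the values of `f + g` and `f * g` lie in the multivalued sum and product of the
values of `f` and `g`. These relations are closed (`ExtReal.mem_mAdd_of_tendsto`,
`ExtReal.mem_mMul_of_tendsto`), so the limit is a real place. The coordinates of the base point
are the values at the variables, so that a continuous left inverse of `δ` can be written down.

That a real place `χ` on `K(x₁, …, xₙ)` which fixes `K` comes from the graphoid means that finitely
many of its values can be approximated by the values at a point of `ℝⁿ`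
(`RealRatFunc.exists_forall_value_mem`). The argument has three ingredients.

* A sum of squares weighted by elements `u` with `0 < χ u < ∞` is zero or a nonzero square times
  such an element, and is never `-1` (`IsRPlace.neg_one_notMem_closure`).
  By Zorn's lemma there is a maximal
  algebraic extension of the field in which `-1` is still no such sum; its weighted sums of squares
  are the nonnegative elements of an ordering which is positive on the weights, and polynomials over
  it have the intermediate value property (`exists_polynomialIVT_extension`). It is a real closed
  field.
* In such an ordering the condition that `f` is close to `χ f` follows from finitely many strict
  sign conditions on polynomials over `K`, which hold at the generic point `(x₁, …, xₙ)`
  (`RealRatFunc.exists_finset_sign_imp_value_mem`).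
* Sign conditions with a solution in one real closed field have a solution in another one as soon as
  the signs of finitely many elements of the coefficient ring agree (`exists_finset_sign_eval₂_eq`,
  Tarski's transfer principle). As `χ` fixes `K`, the ordering restricts to the usual ordering of
  `K ⊆ ℝ`, so there is a solution in `ℝ`.

The transfer is proved one variable at a time with sign tables. Instead of a table there is a
monotone map `g` between the two fields which preserves the signs of all polynomials of a finite
family. A polynomial `p` of maximal degree is added to a family for which such maps exist in both
directions, and which determines the sign of `p'` everywhere and that of `p` at the roots of the
family: between neighbouring roots `p` is strictly monotone, so the signs which it takes there are
determined by the signs at the two ends, and `g` can be corrected inside each interval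
(`IsCellMap.exists_sign_eq`). The information on `p` at the roots of another member `q` is the sign
of a reduction of `p` modulo `q`, of smaller degree than `p`.
-/

/-! ### Polynomials over ordered fields with the intermediate value property -/

open Polynomial in
/-- The intermediate value property for polynomials over an ordered field; it characterizes the
real closed fields among the ordered ones, and is the only form in which real closedness is used. -/
def PolynomialIVT (R : Type*) [Field R] [LinearOrder R] : Prop :=
  ∀ (p : R[X]) (a b : R), a < b → p.eval a * p.eval b < 0 → ∃ c, a < c ∧ c < b ∧ p.eval c = 0

namespace PolynomialIVT

open Polynomial

variable {R : Type*} [Field R] [LinearOrder R] [IsStrictOrderedRing R]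

theorem exists_between_eval_ne_zero {p : R[X]} (hp : p ≠ 0) {a b : R} (hab : a < b) :
    ∃ m, a < m ∧ m < b ∧ p.eval m ≠ 0 := by
  obtain ⟨m, hm, hm'⟩ := (Set.Ioo_infinite hab).exists_notMem_finset p.roots.toFinset
  refine ⟨m, hm.1, hm.2, fun h => hm' ?_⟩
  simp [hp, h]

theorem sign_eval_eq (hR : PolynomialIVT R) {p : R[X]} {a b : R} (hab : a ≤ b)
    (h : ∀ c, a ≤ c → c ≤ b → p.eval c ≠ 0) :
    SignType.sign (p.eval a) = SignType.sign (p.eval b) := by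
  rcases hab.eq_or_lt with rfl | hab
  · rfl
  rcases lt_or_gt_of_ne (h a le_rfl hab.le) with ha | ha <;>
    rcases lt_or_gt_of_ne (h b hab.le le_rfl) with hb | hb
  · rw [sign_neg ha, sign_neg hb]
  · obtain ⟨c, h1, h2, h3⟩ := hR p a b hab (mul_neg_of_neg_of_pos ha hb)
    exact absurd h3 (h c h1.le h2.le)
  · obtain ⟨c, h1, h2, h3⟩ := hR p a b hab (mul_neg_of_pos_of_neg ha hb)
    exact absurd h3 (h c h1.le h2.le)
  · rw [sign_pos ha, sign_pos hb]

/-- Rolle's theorem between consecutive roots, by the algebraic proof: the multiplicities of the two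
roots are divided out of the derivative. -/
theorem exists_derivative_eq_zero_of_consecutive (hR : PolynomialIVT R) {p : R[X]} (hp : p ≠ 0)
    {a b : R} (hab : a < b) (ha : p.eval a = 0) (hb : p.eval b = 0)
    (h : ∀ c, a < c → c < b → p.eval c ≠ 0) :
    ∃ c, a < c ∧ c < b ∧ p.derivative.eval c = 0 := by
  obtain ⟨s, hs, hs'⟩ := exists_eq_pow_rootMultiplicity_mul_and_not_dvd p hp a
  have hm : p.rootMultiplicity a ≠ 0 := by
    rw [← Nat.pos_iff_ne_zero]
    exact (rootMultiplicity_pos hp).2 ha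
  obtain ⟨m, hm⟩ := Nat.exists_eq_succ_of_ne_zero hm
  rw [hm] at hs
  rw [dvd_iff_isRoot, IsRoot.def] at hs'
  have hs0 : s ≠ 0 := by rintro rfl; simp at hs'
  obtain ⟨q, hq, hq'⟩ := exists_eq_pow_rootMultiplicity_mul_and_not_dvd s hs0 b
  have hsb : s.eval b = 0 := by
    rw [hs] at hb
    simpa [(sub_pos.2 hab).ne'] using hb
  have hn : s.rootMultiplicity b ≠ 0 := by
    rw [← Nat.pos_iff_ne_zero]
    exact (rootMultiplicity_pos hs0).2 hsb
  obtain ⟨n, hn⟩ := Nat.exists_eq_succ_of_ne_zero hn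
  rw [hn] at hq
  rw [dvd_iff_isRoot, IsRoot.def] at hq'
  have hqa : q.eval a ≠ 0 := by
    intro h0
    rw [hq] at hs'
    simp [h0] at hs'
  have hsgn : SignType.sign (q.eval a) = SignType.sign (q.eval b) := by
    refine hR.sign_eval_eq hab.le fun c h1 h2 h0 => ?_
    rcases h1.eq_or_lt with rfl | h1
    · exact hqa h0
    rcases h2.eq_or_lt with rfl | h2
    · exact hq' h0
    refine h c h1 h2 ?_
    rw [hs, hq]
    simp [h0]
  -- `p' = (X - a)^m (X - b)^n G`, and `G` changes sign between `a` and `b`.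
  set G : R[X] := (m + 1 : R[X]) * (X - C b) * q + (n + 1 : R[X]) * (X - C a) * q
    + (X - C a) * (X - C b) * derivative q with hG
  have hder : derivative p = (X - C a) ^ m * (X - C b) ^ n * G := by
    rw [hs, hq, hG]
    simp only [derivative_mul, derivative_pow, derivative_sub, derivative_X, derivative_C,
      Nat.succ_eq_add_one, Nat.add_sub_cancel, Nat.cast_add, Nat.cast_one, map_add, map_one,
      map_natCast]
    ring
  have hGa : G.eval a = -((m + 1 : R) * (b - a) * q.eval a) := by
    simp [hG]
    ring
  have hGb : G.eval b = (n + 1 : R) * (b - a) * q.eval b := by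
    simp [hG]
  have hqq : 0 < q.eval a * q.eval b := by
    rcases lt_or_gt_of_ne hqa with h1 | h1
    · rw [sign_neg h1] at hsgn
      exact mul_pos_of_neg_of_neg h1 (sign_eq_neg_one_iff.1 hsgn.symm)
    · rw [sign_pos h1] at hsgn
      exact mul_pos h1 (sign_eq_one_iff.1 hsgn.symm)
  obtain ⟨c, h1, h2, h3⟩ := hR G a b hab (by
    have : 0 < (m + 1 : R) * (b - a) * ((n + 1 : R) * (b - a)) * (q.eval a * q.eval b) := by
      have := sub_pos.2 hab
      positivity
    rw [hGa, hGb]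
    linarith)
  exact ⟨c, h1, h2, by rw [hder]; simp [h3]⟩

/-- Rolle's theorem. -/
theorem exists_derivative_eq_zero (hR : PolynomialIVT R) {p : R[X]}
    {a b : R} (hab : a < b) (ha : p.eval a = 0) (hb : p.eval b = 0) :
    ∃ c, a < c ∧ c < b ∧ p.derivative.eval c = 0 := by
  by_cases hp : p = 0
  · obtain ⟨c, h⟩ := exists_between hab
    exact ⟨c, h.1, h.2, by simp [hp]⟩
  set Z := p.roots.toFinset.filter (a < ·) with hZ
  have hbZ : b ∈ Z := by simp [hZ, hp, hb, hab]
  have hmem := Z.min'_mem ⟨b, hbZ⟩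
  set b' := Z.min' ⟨b, hbZ⟩ with hb'
  have hle : b' ≤ b := Z.min'_le b hbZ
  simp only [hZ, Finset.mem_filter, Multiset.mem_toFinset, mem_roots hp, IsRoot.def] at hmem
  obtain ⟨c, h1, h2, h3⟩ := hR.exists_derivative_eq_zero_of_consecutive hp hmem.2 ha hmem.1
    (fun c h1 h2 h0 => by
      have : c ∈ Z := by simp [hZ, hp, h0, h1]
      exact absurd (Z.min'_le c this) (not_le.2 h2))
  exact ⟨c, h1, h2.trans_le hle, h3⟩

/-- The mean value theorem, in the form of strict monotonicity. -/
theorem eval_lt_eval (hR : PolynomialIVT R) {p : R[X]} {a b : R} (hab : a < b)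
    (h : ∀ c, a < c → c < b → 0 < p.derivative.eval c) : p.eval a < p.eval b := by
  set k := (p.eval b - p.eval a) / (b - a) with hk
  have hba : b - a ≠ 0 := (sub_pos.2 hab).ne'
  obtain ⟨c, h1, h2, h3⟩ := hR.exists_derivative_eq_zero (p := p - C (p.eval a) - C k * (X - C a))
    hab (by simp) (by simp [hk, hba])
  have h4 : p.derivative.eval c = k := by
    simp only [derivative_sub, derivative_C, derivative_mul, derivative_X, eval_sub, eval_mul,
      eval_add, eval_C, eval_X, eval_zero, eval_one] at h3
    linarith
  have h5 := h c h1 h2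
  rw [h4, hk] at h5
  have h6 := (div_pos_iff_of_pos_right (sub_pos.2 hab)).1 h5
  linarith

theorem exists_pos_le_abs_eval {p : R[X]} (hp : p ≠ 0) :
    ∃ c > 0, ∃ N, ∀ s, N ≤ |s| → c ≤ |p.eval s| := by
  induction hn : p.natDegree using Nat.strong_induction_on generalizing p with
  | _ n ih =>
  have hdiv := divX_mul_X_add p
  by_cases h0 : p.divX = 0
  · rw [h0, zero_mul, zero_add] at hdiv
    have hc : p.coeff 0 ≠ 0 := fun h => hp (by rw [← hdiv, h, C_0])
    exact ⟨|p.coeff 0|, abs_pos.2 hc, 0, fun s _ => by rw [← hdiv]; simp⟩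
  · have hlt : p.divX.natDegree < n := by
      rw [natDegree_divX_eq_natDegree_tsub_one, ← hn]
      refine Nat.sub_lt (Nat.pos_of_ne_zero fun h => h0 ?_) one_pos
      rw [divX_eq_zero_iff]
      exact eq_C_of_natDegree_eq_zero h
    obtain ⟨c, hc, N, hN⟩ := ih _ hlt h0 rfl
    refine ⟨c, hc, max N ((c + |p.coeff 0|) / c), fun s hs => ?_⟩
    have h1 := hN s ((le_max_left _ _).trans hs)
    have h2 := (div_le_iff₀ hc).1 ((le_max_right _ _).trans hs)
    have h3 : p.eval s = p.divX.eval s * s + p.coeff 0 := by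
      conv_lhs => rw [← hdiv]
      simp
    have h4 := abs_sub_abs_le_abs_add (p.divX.eval s * s) (p.coeff 0)
    rw [abs_mul, ← h3] at h4
    have h5 : |s| * c ≤ |p.divX.eval s| * |s| := by
      rw [mul_comm]
      exact mul_le_mul_of_nonneg_right h1 (abs_nonneg s)
    linarith

/-- A nonconstant polynomial is unbounded at infinity, over any ordered field. -/
theorem exists_lt_abs_eval {p : R[X]} (hp : p.derivative ≠ 0) (B : R) :
    ∃ N, ∀ s, N ≤ |s| → B < |p.eval s| := by
  have hdiv := divX_mul_X_add p
  have h0 : p.divX ≠ 0 := by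
    intro h0
    rw [h0, zero_mul, zero_add] at hdiv
    apply hp
    rw [← hdiv, derivative_C]
  obtain ⟨c, hc, N, hN⟩ := exists_pos_le_abs_eval h0
  refine ⟨max N ((B + |p.coeff 0| + 1) / c), fun s hs => ?_⟩
  have h1 := hN s ((le_max_left _ _).trans hs)
  have h2 := (div_le_iff₀ hc).1 ((le_max_right _ _).trans hs)
  have h3 : p.eval s = p.divX.eval s * s + p.coeff 0 := by
    conv_lhs => rw [← hdiv]
    simp
  have h4 := abs_sub_abs_le_abs_add (p.divX.eval s * s) (p.coeff 0)
  rw [abs_mul, ← h3] at h4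
  have h5 : |s| * c ≤ |p.divX.eval s| * |s| := by
    rw [mul_comm]
    exact mul_le_mul_of_nonneg_right h1 (abs_nonneg s)
  linarith

theorem exists_left_eval_pos (hR : PolynomialIVT R) {p : R[X]} {a b : R} (hab : a < b)
    (hb : 0 < p.eval b) : ∃ s, a < s ∧ s < b ∧ 0 < p.eval s := by
  have hp : p ≠ 0 := by rintro rfl; simp at hb
  set Z := insert a (p.roots.toFinset.filter (· < b)) with hZ
  have hne : Z.Nonempty := ⟨a, by simp [hZ]⟩
  have hlt : Z.max' hne < b := by
    rw [Finset.max'_lt_iff]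
    intro y hy
    simp only [hZ, Finset.mem_insert, Finset.mem_filter] at hy
    rcases hy with rfl | hy
    exacts [hab, hy.2]
  obtain ⟨s, h1, h2⟩ := exists_between hlt
  refine ⟨s, (Z.le_max' a (by simp [hZ])).trans_lt h1, h2, ?_⟩
  rw [← sign_eq_one_iff, hR.sign_eval_eq h2.le, sign_pos hb]
  intro c h3 h4 h0
  rcases h4.eq_or_lt with rfl | h4
  · exact hb.ne' h0
  · exact absurd (h1.trans_le h3) (not_lt.2 (Z.le_max' c (by simp [hZ, hp, h0, h4])))

theorem exists_right_eval_neg (hR : PolynomialIVT R) {p : R[X]} {a b : R} (hab : a < b)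
    (ha : p.eval a < 0) : ∃ s, a < s ∧ s < b ∧ p.eval s < 0 := by
  have hp : p ≠ 0 := by rintro rfl; simp at ha
  set Z := insert b (p.roots.toFinset.filter (a < ·)) with hZ
  have hne : Z.Nonempty := ⟨b, by simp [hZ]⟩
  have hlt : a < Z.min' hne := by
    rw [Finset.lt_min'_iff]
    intro y hy
    simp only [hZ, Finset.mem_insert, Finset.mem_filter] at hy
    rcases hy with rfl | hy
    exacts [hab, hy.2]
  obtain ⟨s, h1, h2⟩ := exists_between hlt
  refine ⟨s, h1, h2.trans_le (Z.min'_le b (by simp [hZ])), ?_⟩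
  rw [← sign_eq_neg_one_iff, ← hR.sign_eval_eq h1.le, sign_neg ha]
  intro c h3 h4 h0
  rcases h3.eq_or_lt with rfl | h3
  · exact ha.ne h0
  · exact absurd (h4.trans_lt h2) (not_lt.2 (Z.min'_le c (by simp [hZ, hp, h0, h3])))

end PolynomialIVT

/-! ### Monotone maps of lines cut into cells -/

/-- Two points are in the same open cell of the line cut at the points of `Z`: neither is in `Z`,
and no point of `Z` separates them. -/
def SameCell {R : Type*} [LinearOrder R] (Z : Set R) (u s : R) : Prop :=
  ∀ z ∈ Z, (z < u ∧ z < s) ∨ (u < z ∧ s < z)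

namespace SameCell

variable {R : Type*} [LinearOrder R] {Z : Set R} {u s v : R}

theorem symm (h : SameCell Z u s) : SameCell Z s u := fun z hz =>
  (h z hz).imp And.symm And.symm

theorem trans (h : SameCell Z u s) (h' : SameCell Z s v) : SameCell Z u v := by
  intro z hz
  rcases h z hz with h1 | h1 <;> rcases h' z hz with h2 | h2
  · exact Or.inl ⟨h1.1, h2.2⟩
  · exact absurd h1.2 h2.1.asymm
  · exact absurd h1.2 h2.1.asymm
  · exact Or.inr ⟨h1.1, h2.2⟩

theorem of_le (h : u ≤ s) (hZ : ∀ z ∈ Z, u ≤ z → z ≤ s → False) : SameCell Z u s := by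
  intro z hz
  rcases lt_or_ge z u with h1 | h1
  · exact Or.inl ⟨h1, h1.trans_le h⟩
  · have h2 : s < z := not_le.1 fun h2 => hZ z hz h1 h2
    exact Or.inr ⟨h.trans_lt h2, h2⟩

theorem notMem_of_mem_Icc (h : SameCell Z u s) {c : R} (h1 : u ≤ c) (h2 : c ≤ s) : c ∉ Z := by
  intro hc
  rcases h c hc with h3 | h3
  · exact absurd h3.1 (not_lt.2 h1)
  · exact absurd h3.2 (not_lt.2 h2)

open Polynomial in
theorem sign_eval_eq {R : Type*} [Field R] [LinearOrder R] [IsStrictOrderedRing R] {Z : Set R}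
    {u s : R} (h : SameCell Z u s) (hR : PolynomialIVT R) {p : R[X]}
    (hp : ∀ c, p.eval c = 0 → c ∈ Z) :
    SignType.sign (p.eval u) = SignType.sign (p.eval s) := by
  rcases le_total u s with h1 | h1
  · exact hR.sign_eval_eq h1 fun c h2 h3 h4 => h.notMem_of_mem_Icc h2 h3 (hp c h4)
  · exact (hR.sign_eval_eq h1 fun c h2 h3 h4 => h.symm.notMem_of_mem_Icc h2 h3 (hp c h4)).symm

open Polynomial in
theorem eval_lt_eval {R : Type*} [Field R] [LinearOrder R] [IsStrictOrderedRing R] {Z : Set R}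
    {u s : R} (h : SameCell Z u s) (hR : PolynomialIVT R) {p : R[X]}
    (hp : ∀ c, p.derivative.eval c = 0 → c ∈ Z) (hu : 0 < p.derivative.eval u) (hus : u < s) :
    p.eval u < p.eval s := by
  refine hR.eval_lt_eval hus fun c h1 h2 => ?_
  rw [← sign_eq_one_iff, ← hR.sign_eval_eq h1.le, sign_pos hu]
  exact fun d h3 h4 h5 => h.notMem_of_mem_Icc h3 (h4.trans h2.le) (hp d h5)

end SameCell

/-- A monotone map which restricts to a bijection of two finite sets of cut points and maps cells
to the corresponding cells. -/
structure IsCellMap {R₁ R₂ : Type*} [LinearOrder R₁] [LinearOrder R₂] (Z₁ : Set R₁) (Z₂ : Set R₂)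
    (g : R₁ → R₂) : Prop where
  monotone : Monotone g
  finite : Z₁.Finite
  image : g '' Z₁ = Z₂
  notMem : ∀ t, t ∉ Z₁ → g t ∉ Z₂

theorem IsCellMap.lt_of_lt {R₁ R₂ : Type*} [LinearOrder R₁] [LinearOrder R₂] {Z₁ : Set R₁}
    {Z₂ : Set R₂} {g : R₁ → R₂}
    (hg : IsCellMap Z₁ Z₂ g) {a b : R₁} (hab : a < b) (h : a ∈ Z₁ ∧ b ∉ Z₁ ∨
    a ∉ Z₁ ∧ b ∈ Z₁) : g a < g b := by
  refine (hg.monotone hab.le).lt_of_ne fun h0 => ?_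
  rcases h with ⟨ha, hb⟩ | ⟨ha, hb⟩
  · exact hg.notMem b hb (h0 ▸ hg.image ▸ Set.mem_image_of_mem g ha)
  · exact hg.notMem a ha (h0 ▸ hg.image ▸ Set.mem_image_of_mem g hb)

section CellMap

open Polynomial

variable {R₁ R₂ : Type*} [Field R₁] [LinearOrder R₁] [IsStrictOrderedRing R₁]
  [Field R₂] [LinearOrder R₂] [IsStrictOrderedRing R₂]

namespace IsCellMap

variable {Z₁ : Set R₁} {Z₂ : Set R₂} {g : R₁ → R₂} {p : R₁[X]} {q : R₂[X]} {t : R₁}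

/-- If `p ≥ 0` at a point of a cell on which `p` increases, then `p > 0` at the right end of the
cell, so `q > 0` near the right end of the corresponding cell; if this is unbounded, `q` tends to
infinity there. -/
theorem exists_sameCell_pos (hg : IsCellMap Z₁ Z₂ g) (hR₁ : PolynomialIVT R₁)
    (hR₂ : PolynomialIVT R₂) (hp : ∀ c, p.derivative.eval c = 0 → c ∈ Z₁)
    (hq : ∀ c, q.derivative.eval c = 0 → c ∈ Z₂)
    (hpq : ∀ z ∈ Z₁, SignType.sign (p.eval z) = SignType.sign (q.eval (g z))) (ht : t ∉ Z₁)
    (hpt : 0 < p.derivative.eval t) (hqt : 0 < q.derivative.eval (g t)) (h0 : 0 ≤ p.eval t) :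
    ∃ s, SameCell Z₂ (g t) s ∧ 0 < q.eval s := by
  by_cases hne : (hg.finite.toFinset.filter (t < ·)).Nonempty
  · have hmem := Finset.min'_mem _ hne
    have hmin := Finset.min'_le (hg.finite.toFinset.filter (t < ·))
    set b := Finset.min' _ hne
    simp only [Finset.mem_filter, Set.Finite.mem_toFinset] at hmem hmin
    have hpb : 0 < p.eval b := by
      refine h0.trans_lt (hR₁.eval_lt_eval hmem.2 fun c h1 h2 => ?_)
      rw [← sign_eq_one_iff, ← hR₁.sign_eval_eq h1.le, sign_pos hpt]
      intro d h3 h4 h5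
      have hd := hp d h5
      rcases h3.eq_or_lt with rfl | h3
      · exact ht hd
      · exact absurd (hmin d ⟨hd, h3⟩) (not_le.2 (h4.trans_lt h2))
    rw [← sign_eq_one_iff, hpq b hmem.1, sign_eq_one_iff] at hpb
    obtain ⟨s, h1, h2, h3⟩ :=
      hR₂.exists_left_eval_pos (hg.lt_of_lt hmem.2 (Or.inr ⟨ht, hmem.1⟩)) hpb
    refine ⟨s, SameCell.of_le h1.le fun z hz h4 h5 => ?_, h3⟩
    rw [← hg.image] at hz
    obtain ⟨z, hz, rfl⟩ := hz
    have h6 : z < b := not_le.1 fun h => absurd (hg.monotone h) (not_le.2 (h5.trans_lt h2))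
    rcases lt_or_ge t z with h7 | h7
    · exact absurd (hmin z ⟨hz, h7⟩) (not_le.2 h6)
    · rcases h7.eq_or_lt with rfl | h7
      · exact ht hz
      · exact absurd (hg.lt_of_lt h7 (Or.inl ⟨hz, ht⟩)) (not_lt.2 h4)
  · have hnone : ∀ z ∈ Z₁, z < t := by
      intro z hz
      by_contra h
      refine hne ⟨z, ?_⟩
      simp only [Finset.mem_filter, Set.Finite.mem_toFinset]
      exact ⟨hz, (not_lt.1 h).lt_of_ne fun h => ht (h ▸ hz)⟩
    obtain ⟨N, hN⟩ := PolynomialIVT.exists_lt_abs_eval (p := q)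
      (by intro h; rw [h] at hqt; simp at hqt) |q.eval (g t)|
    set s := max N (g t + 1) with hs
    have hts : g t < s := (lt_add_one _).trans_le (le_max_right _ _)
    have hcell : SameCell Z₂ (g t) s := by
      refine SameCell.of_le hts.le fun z hz h4 _ => ?_
      rw [← hg.image] at hz
      obtain ⟨z, hz, rfl⟩ := hz
      exact absurd (hg.lt_of_lt (hnone z hz) (Or.inl ⟨hz, ht⟩)) (not_lt.2 h4)
    have h1 := hN s ((le_max_left _ _).trans (le_abs_self s))
    have h2 := hcell.eval_lt_eval hR₂ hq hqt hts
    refine ⟨s, hcell, not_le.1 fun h => ?_⟩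
    rw [abs_of_nonpos h, abs_of_neg (h2.trans_le h)] at h1
    linarith

/-- The counterpart of `exists_sameCell_pos` at the left end of a cell. -/
theorem exists_sameCell_neg (hg : IsCellMap Z₁ Z₂ g) (hR₁ : PolynomialIVT R₁)
    (hR₂ : PolynomialIVT R₂) (hp : ∀ c, p.derivative.eval c = 0 → c ∈ Z₁)
    (hq : ∀ c, q.derivative.eval c = 0 → c ∈ Z₂)
    (hpq : ∀ z ∈ Z₁, SignType.sign (p.eval z) = SignType.sign (q.eval (g z))) (ht : t ∉ Z₁)
    (hpt : 0 < p.derivative.eval t) (hqt : 0 < q.derivative.eval (g t)) (h0 : p.eval t ≤ 0) :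
    ∃ s, SameCell Z₂ (g t) s ∧ q.eval s < 0 := by
  by_cases hne : (hg.finite.toFinset.filter (· < t)).Nonempty
  · have hmem := Finset.max'_mem _ hne
    have hmax := Finset.le_max' (hg.finite.toFinset.filter (· < t))
    set b := Finset.max' _ hne
    simp only [Finset.mem_filter, Set.Finite.mem_toFinset] at hmem hmax
    have hpb : p.eval b < 0 := by
      refine (hR₁.eval_lt_eval hmem.2 fun c h1 h2 => ?_).trans_le h0
      rw [← sign_eq_one_iff, hR₁.sign_eval_eq h2.le, sign_pos hpt]
      intro d h3 h4 h5
      have hd := hp d h5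
      rcases h4.eq_or_lt with rfl | h4
      · exact ht hd
      · exact absurd (hmax d ⟨hd, h4⟩) (not_le.2 (h1.trans_le h3))
    rw [← sign_eq_neg_one_iff, hpq b hmem.1, sign_eq_neg_one_iff] at hpb
    obtain ⟨s, h1, h2, h3⟩ :=
      hR₂.exists_right_eval_neg (hg.lt_of_lt hmem.2 (Or.inl ⟨hmem.1, ht⟩)) hpb
    refine ⟨s, (SameCell.of_le h2.le fun z hz h4 h5 => ?_).symm, h3⟩
    rw [← hg.image] at hz
    obtain ⟨z, hz, rfl⟩ := hz
    have h6 : b < z := not_le.1 fun h => absurd (hg.monotone h) (not_le.2 (h1.trans_le h4))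
    rcases lt_or_ge z t with h7 | h7
    · exact absurd (hmax z ⟨hz, h7⟩) (not_le.2 h6)
    · rcases h7.eq_or_lt with rfl | h7
      · exact ht hz
      · exact absurd (hg.lt_of_lt h7 (Or.inr ⟨ht, hz⟩)) (not_lt.2 h5)
  · have hnone : ∀ z ∈ Z₁, t < z := by
      intro z hz
      by_contra h
      refine hne ⟨z, ?_⟩
      simp only [Finset.mem_filter, Set.Finite.mem_toFinset]
      exact ⟨hz, (not_lt.1 h).lt_of_ne fun h => ht (h ▸ hz)⟩
    obtain ⟨N, hN⟩ := PolynomialIVT.exists_lt_abs_eval (p := q)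
      (by intro h; rw [h] at hqt; simp at hqt) |q.eval (g t)|
    set s := min (-N) (g t - 1) with hs
    have hts : s < g t := (min_le_right _ _).trans_lt (sub_one_lt _)
    have hcell : SameCell Z₂ s (g t) := by
      refine SameCell.of_le hts.le fun z hz _ h4 => ?_
      rw [← hg.image] at hz
      obtain ⟨z, hz, rfl⟩ := hz
      exact absurd (hg.lt_of_lt (hnone z hz) (Or.inr ⟨ht, hz⟩)) (not_lt.2 h4)
    have h1 := hN s ((le_neg_of_le_neg (min_le_left _ _)).trans (neg_le_abs s))
    have h2 := hcell.eval_lt_eval hR₂ hq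
      (by rwa [← sign_eq_one_iff, hcell.sign_eval_eq hR₂ hq, sign_eq_one_iff]) hts
    refine ⟨s, hcell.symm, not_le.1 fun h => ?_⟩
    rw [abs_of_nonneg h, abs_of_pos (h.trans_lt h2)] at h1
    linarith

/-- A sign which `p` takes in a cell is taken by `q` in the corresponding cell. -/
theorem exists_sameCell_sign_eq_of_pos (hg : IsCellMap Z₁ Z₂ g) (hR₁ : PolynomialIVT R₁)
    (hR₂ : PolynomialIVT R₂) (hp : ∀ c, p.derivative.eval c = 0 → c ∈ Z₁)
    (hq : ∀ c, q.derivative.eval c = 0 → c ∈ Z₂)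
    (hpq : ∀ z ∈ Z₁, SignType.sign (p.eval z) = SignType.sign (q.eval (g z))) (ht : t ∉ Z₁)
    (hpt : 0 < p.derivative.eval t) (hqt : 0 < q.derivative.eval (g t)) :
    ∃ s, SameCell Z₂ (g t) s ∧ SignType.sign (q.eval s) = SignType.sign (p.eval t) := by
  rcases lt_trichotomy (p.eval t) 0 with h | h | h
  · obtain ⟨s, h1, h2⟩ := hg.exists_sameCell_neg hR₁ hR₂ hp hq hpq ht hpt hqt h.le
    exact ⟨s, h1, by rw [sign_neg h, sign_neg h2]⟩
  · obtain ⟨s, h1, h2⟩ := hg.exists_sameCell_neg hR₁ hR₂ hp hq hpq ht hpt hqt h.le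
    obtain ⟨s', h1', h2'⟩ := hg.exists_sameCell_pos hR₁ hR₂ hp hq hpq ht hpt hqt h.ge
    have hss := h1.symm.trans h1'
    have key : ∃ c, SameCell Z₂ s c ∧ q.eval c = 0 := by
      rcases lt_trichotomy s s' with h3 | h3 | h3
      · obtain ⟨c, h4, h5, h6⟩ := hR₂ q s s' h3 (mul_neg_of_neg_of_pos h2 h2')
        exact ⟨c, SameCell.of_le h4.le fun z hz h7 h8 =>
          hss.notMem_of_mem_Icc h7 (h8.trans h5.le) hz, h6⟩
      · rw [h3] at h2
        exact absurd h2 h2'.asymm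
      · obtain ⟨c, h4, h5, h6⟩ := hR₂ q s' s h3 (mul_neg_of_pos_of_neg h2' h2)
        exact ⟨c, (SameCell.of_le h5.le fun z hz h7 h8 =>
          hss.symm.notMem_of_mem_Icc (h4.le.trans h7) h8 hz).symm, h6⟩
    obtain ⟨c, h4, h5⟩ := key
    exact ⟨c, h1.trans h4, by rw [h, h5]; simp⟩
  · obtain ⟨s, h1, h2⟩ := hg.exists_sameCell_pos hR₁ hR₂ hp hq hpq ht hpt hqt h.le
    exact ⟨s, h1, by rw [sign_pos h, sign_pos h2]⟩

theorem exists_sameCell_sign_eq (hg : IsCellMap Z₁ Z₂ g) (hR₁ : PolynomialIVT R₁)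
    (hR₂ : PolynomialIVT R₂) (hp : ∀ c, p.derivative.eval c = 0 → c ∈ Z₁)
    (hq : ∀ c, q.derivative.eval c = 0 → c ∈ Z₂)
    (hpq : ∀ z ∈ Z₁, SignType.sign (p.eval z) = SignType.sign (q.eval (g z))) (ht : t ∉ Z₁)
    (hd : SignType.sign (p.derivative.eval t) = SignType.sign (q.derivative.eval (g t))) :
    ∃ s, SameCell Z₂ (g t) s ∧ SignType.sign (q.eval s) = SignType.sign (p.eval t) := by
  rcases lt_trichotomy (p.derivative.eval t) 0 with h | h | h
  · obtain ⟨s, h1, h2⟩ := hg.exists_sameCell_sign_eq_of_pos hR₁ hR₂ (p := -p) (q := -q) (t := t)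
      (fun c hc => hp c (by simpa using hc)) (fun c hc => hq c (by simpa using hc))
      (fun z hz => by simp [Left.sign_neg, hpq z hz]) ht (by simpa using h)
      (by
        rw [sign_neg h] at hd
        simpa using sign_eq_neg_one_iff.1 hd.symm)
    refine ⟨s, h1, ?_⟩
    simpa [Left.sign_neg] using h2
  · exact absurd (hp t h) ht
  · rw [sign_pos h] at hd
    exact hg.exists_sameCell_sign_eq_of_pos hR₁ hR₂ hp hq hpq ht h (sign_eq_one_iff.1 hd.symm)

/-- Points of corresponding cells at which corresponding strictly monotone polynomials have the same
two distinct signs are in the same order. -/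
theorem le_of_sign_eq_of_pos {u s : R₁} {u' s' : R₂} (hR₁ : PolynomialIVT R₁)
    (hR₂ : PolynomialIVT R₂) (hp : ∀ c, p.derivative.eval c = 0 → c ∈ Z₁)
    (hq : ∀ c, q.derivative.eval c = 0 → c ∈ Z₂)
    (h1 : SameCell Z₁ u s) (h2 : SameCell Z₂ u' s') (hpu : 0 < p.derivative.eval u)
    (hqu : 0 < q.derivative.eval u') (hus : u ≤ s)
    (hu : SignType.sign (q.eval u') = SignType.sign (p.eval u))
    (hs : SignType.sign (q.eval s') = SignType.sign (p.eval s))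
    (hne : SignType.sign (p.eval u) ≠ SignType.sign (p.eval s)) : u' ≤ s' := by
  by_contra! hlt
  have hus : u < s := hus.lt_of_ne (by rintro rfl; exact hne rfl)
  have h3 := h1.eval_lt_eval hR₁ hp hpu hus
  have h4 := h2.symm.eval_lt_eval hR₂ hq
    (by rwa [← sign_eq_one_iff, ← h2.sign_eval_eq hR₂ hq, sign_eq_one_iff]) hlt
  have h5 := SignType.sign.monotone h3.le
  have h6 := SignType.sign.monotone h4.le
  rw [hu, hs] at h6
  exact hne (le_antisymm h5 h6)

theorem le_of_sign_eq {u s : R₁} {u' s' : R₂} (hR₁ : PolynomialIVT R₁)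
    (hR₂ : PolynomialIVT R₂) (hp : ∀ c, p.derivative.eval c = 0 → c ∈ Z₁)
    (hq : ∀ c, q.derivative.eval c = 0 → c ∈ Z₂)
    (h1 : SameCell Z₁ u s) (h2 : SameCell Z₂ u' s') (hu1 : u ∉ Z₁)
    (hd : SignType.sign (p.derivative.eval u) = SignType.sign (q.derivative.eval u'))
    (hus : u ≤ s)
    (hu : SignType.sign (q.eval u') = SignType.sign (p.eval u))
    (hs : SignType.sign (q.eval s') = SignType.sign (p.eval s))
    (hne : SignType.sign (p.eval u) ≠ SignType.sign (p.eval s)) : u' ≤ s' := by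
  rcases lt_trichotomy (p.derivative.eval u) 0 with h | h | h
  · rw [sign_neg h] at hd
    refine le_of_sign_eq_of_pos (p := -p) (q := -q) hR₁ hR₂
      (fun c hc => hp c (by simpa using hc)) (fun c hc => hq c (by simpa using hc)) h1 h2
      (by simpa using h) (by simpa using sign_eq_neg_one_iff.1 hd.symm) hus ?_ ?_ ?_
    · simp [Left.sign_neg, hu]
    · simp [Left.sign_neg, hs]
    · simpa [Left.sign_neg] using hne
  · exact absurd (hp u h) hu1
  · rw [sign_pos h] at hd
    exact le_of_sign_eq_of_pos hR₁ hR₂ hp hq h1 h2 h (sign_eq_one_iff.1 hd.symm) hus hu hs hne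

/-- A cell map can be changed inside the cells so as to preserve the sign of one more polynomial,
provided that it preserves the sign at the cut points and the sign of the derivative, whose roots
are among the cut points: inside a cell such a polynomial is strictly monotone. -/
theorem exists_sign_eq (hg : IsCellMap Z₁ Z₂ g) (hR₁ : PolynomialIVT R₁)
    (hR₂ : PolynomialIVT R₂) (hp : ∀ c, p.derivative.eval c = 0 → c ∈ Z₁)
    (hq : ∀ c, q.derivative.eval c = 0 → c ∈ Z₂)
    (hpq : ∀ z ∈ Z₁, SignType.sign (p.eval z) = SignType.sign (q.eval (g z)))
    (hd : ∀ t, SignType.sign (p.derivative.eval t) = SignType.sign (q.derivative.eval (g t))) :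
    ∃ g' : R₁ → R₂, Monotone g' ∧ (∀ t ∈ Z₁, g' t = g t) ∧ (∀ t ∉ Z₁, SameCell Z₂ (g t) (g' t)) ∧
      ∀ t, SignType.sign (p.eval t) = SignType.sign (q.eval (g' t)) := by
  classical
  -- The new value depends only on the cell and on the sign of `p`, so that it is monotone.
  let A : R₁ → Set R₂ := fun t =>
    {s | SameCell Z₂ (g t) s ∧ SignType.sign (q.eval s) = SignType.sign (p.eval t)}
  let g' : R₁ → R₂ := fun t => if t ∈ Z₁ then g t else Classical.epsilon (· ∈ A t)
  have hin : ∀ t ∈ Z₁, g' t = g t := fun t ht => if_pos ht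
  have hout' : ∀ t ∉ Z₁, g' t = Classical.epsilon (· ∈ A t) := fun t ht => if_neg ht
  have hout : ∀ t ∉ Z₁, g' t ∈ A t := by
    intro t ht
    rw [hout' t ht]
    exact Classical.epsilon_spec
      (hg.exists_sameCell_sign_eq hR₁ hR₂ hp hq hpq ht (hd t))
  have himg : ∀ t ∈ Z₁, g t ∈ Z₂ := fun t ht => hg.image ▸ Set.mem_image_of_mem g ht
  refine ⟨g', fun t₁ t₂ h12 => ?_, hin, fun t ht => (hout t ht).1, fun t => ?_⟩
  · rcases h12.eq_or_lt with rfl | h12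
    · exact le_rfl
    by_cases h1 : t₁ ∈ Z₁ <;> by_cases h2 : t₂ ∈ Z₁
    · rw [hin _ h1, hin _ h2]
      exact hg.monotone h12.le
    · rw [hin _ h1]
      have h3 := hg.lt_of_lt h12 (Or.inl ⟨h1, h2⟩)
      rcases (hout t₂ h2).1 _ (himg _ h1) with h4 | h4
      · exact h4.2.le
      · exact absurd h3 h4.1.asymm
    · rw [hin _ h2]
      have h3 := hg.lt_of_lt h12 (Or.inr ⟨h1, h2⟩)
      rcases (hout t₁ h1).1 _ (himg _ h2) with h4 | h4
      · exact absurd h3 h4.1.asymm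
      · exact h4.2.le
    · by_cases hz : ∃ z ∈ Z₂, g t₁ < z ∧ z < g t₂
      · obtain ⟨z, hz, h3, h4⟩ := hz
        have h5 : g' t₁ < z := by
          rcases (hout t₁ h1).1 z hz with h | h
          · exact absurd h3 h.1.asymm
          · exact h.2
        have h6 : z < g' t₂ := by
          rcases (hout t₂ h2).1 z hz with h | h
          · exact h.2
          · exact absurd h4 h.1.asymm
        exact (h5.trans h6).le
      · push Not at hz
        have hcell : SameCell Z₂ (g t₁) (g t₂) := by
          refine SameCell.of_le (hg.monotone h12.le) fun z hz' h3 h4 => ?_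
          rcases h3.eq_or_lt with rfl | h3
          · exact hg.notMem t₁ h1 hz'
          rcases h4.eq_or_lt with rfl | h4
          · exact hg.notMem t₂ h2 hz'
          exact absurd h4 (not_lt.2 (hz z hz' h3))
        by_cases hs : SignType.sign (p.eval t₁) = SignType.sign (p.eval t₂)
        · have hA : A t₁ = A t₂ := by
            ext s
            simp only [A, Set.mem_ofPred_eq, hs]
            exact and_congr_left fun _ => ⟨hcell.symm.trans, hcell.trans⟩
          rw [hout' _ h1, hout' _ h2, hA]
        · have hcell₁ : SameCell Z₁ t₁ t₂ := by
            refine SameCell.of_le h12.le fun z hz' h3 h4 => ?_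
            rcases h3.eq_or_lt with rfl | h3
            · exact h1 hz'
            rcases h4.eq_or_lt with rfl | h4
            · exact h2 hz'
            have h5 := hg.lt_of_lt h3 (Or.inr ⟨h1, hz'⟩)
            exact absurd (hg.lt_of_lt h4 (Or.inl ⟨hz', h2⟩))
              (not_lt.2 (hz _ (himg _ hz') h5))
          have hc₂ := ((hout t₁ h1).1.symm.trans hcell).trans (hout t₂ h2).1
          refine le_of_sign_eq hR₁ hR₂ hp hq hcell₁ hc₂ h1 ?_ h12.le (hout t₁ h1).2
            (hout t₂ h2).2 hs
          rw [hd t₁, (hout t₁ h1).1.sign_eval_eq hR₂ hq]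
  · by_cases ht : t ∈ Z₁
    · rw [hin t ht, hpq t ht]
    · exact (hout t ht).2.symm

end IsCellMap

end CellMap

/-! ### Sign tables and the transfer principle -/

section CutSet

open Polynomial

/-- The set of the roots of the nonzero polynomials of a finite family. -/
def cutSet {ι R : Type*} [Field R] (s : Multiset ι) (P : ι → R[X]) : Set R :=
  {t | ∃ i ∈ s, P i ≠ 0 ∧ (P i).eval t = 0}

theorem finite_cutSet {ι R : Type*} [Field R] (s : Multiset ι) (P : ι → R[X]) :
    (cutSet s P).Finite := by
  classical
  refine (s.toFinset.biUnion fun i => (P i).roots.toFinset).finite_toSet.subset ?_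
  rintro t ⟨i, hi, h0, ht⟩
  simp only [Finset.coe_biUnion, Set.mem_iUnion, Finset.mem_coe, Multiset.mem_toFinset,
    mem_roots']
  exact ⟨i, hi, h0, ht⟩

/-- The monotone map `g` preserves the signs of corresponding polynomials of two families. -/
structure IsSignMap {ι R₁ R₂ : Type*} [Field R₁] [LinearOrder R₁] [Field R₂] [LinearOrder R₂]
    (s : Multiset ι) (P : ι → R₁[X]) (Q : ι → R₂[X]) (g : R₁ → R₂) : Prop where
  monotone : Monotone g
  sign_eq : ∀ i ∈ s, ∀ t, SignType.sign ((P i).eval t) = SignType.sign ((Q i).eval (g t))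

namespace IsSignMap

variable {R₁ R₂ ι : Type*} [Field R₁] [LinearOrder R₁] [Field R₂] [LinearOrder R₂]
  {s : Multiset ι} {P : ι → R₁[X]} {Q : ι → R₂[X]} {g : R₁ → R₂}

theorem mono {s' : Multiset ι} (hg : IsSignMap s P Q g) (h : ∀ i ∈ s', i ∈ s) :
    IsSignMap s' P Q g :=
  ⟨hg.monotone, fun i hi => hg.sign_eq i (h i hi)⟩

theorem eval_eq_zero_iff (hg : IsSignMap s P Q g) {i : ι} (hi : i ∈ s) (t : R₁) :
    (Q i).eval (g t) = 0 ↔ (P i).eval t = 0 := by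
  rw [← sign_eq_zero_iff, ← hg.sign_eq i hi t, sign_eq_zero_iff]

theorem ne_zero [IsStrictOrderedRing R₁] (hg : IsSignMap s P Q g) {i : ι} (hi : i ∈ s)
    (h0 : P i ≠ 0) : Q i ≠ 0 := by
  intro hQ
  obtain ⟨t, -, -, ht⟩ := PolynomialIVT.exists_between_eval_ne_zero h0 (zero_lt_one' R₁)
  exact ht ((hg.eval_eq_zero_iff hi t).1 (by simp [hQ]))

theorem mapsTo_cutSet [IsStrictOrderedRing R₁] (hg : IsSignMap s P Q g) :
    Set.MapsTo g (cutSet s P) (cutSet s Q) := by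
  rintro t ⟨i, hi, h0, ht⟩
  exact ⟨i, hi, hg.ne_zero hi h0, (hg.eval_eq_zero_iff hi t).2 ht⟩

theorem injOn_cutSet [IsStrictOrderedRing R₁] (hg : IsSignMap s P Q g) :
    Set.InjOn g (cutSet s P) := by
  have key : ∀ a ∈ cutSet s P, ∀ b, a < b → g a ≠ g b := by
    rintro a ⟨i, hi, h0, ha⟩ b hab h
    obtain ⟨m, h1, h2, h3⟩ := PolynomialIVT.exists_between_eval_ne_zero h0 hab
    have h4 : g a = g m :=
      le_antisymm (hg.monotone h1.le) (by rw [h]; exact hg.monotone h2.le)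
    exact h3 ((hg.eval_eq_zero_iff hi m).1 (by rw [← h4]; exact (hg.eval_eq_zero_iff hi a).2 ha))
  intro a ha b hb h
  by_contra hne
  rcases lt_or_gt_of_ne hne with h1 | h1
  · exact key a ha b h1 h
  · exact key b hb a h1 h.symm

end IsSignMap

namespace IsSignMap

variable {R₁ R₂ : Type*} [Field R₁] [LinearOrder R₁] [IsStrictOrderedRing R₁]
  [Field R₂] [LinearOrder R₂] [IsStrictOrderedRing R₂]

variable {ι : Type*} {s : Multiset ι} {P : ι → R₁[X]} {Q : ι → R₂[X]} {g : R₁ → R₂}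
  {h : R₂ → R₁}

/-- Sign maps in both directions: as each is injective on the cut points, the numbers of cut points
agree. -/
theorem isCellMap (hg : IsSignMap s P Q g) (hh : IsSignMap s Q P h) :
    IsCellMap (cutSet s P) (cutSet s Q) g where
  monotone := hg.monotone
  finite := finite_cutSet s P
  image := by
    refine Set.eq_of_subset_of_ncard_le hg.mapsTo_cutSet.image_subset ?_ (finite_cutSet s Q)
    rw [hg.injOn_cutSet.ncard_image]
    exact Set.ncard_le_ncard_of_injOn h hh.mapsTo_cutSet hh.injOn_cutSet (finite_cutSet s P)
  notMem := by
    rintro t ht ⟨i, hi, h0, h1⟩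
    exact ht ⟨i, hi, hh.ne_zero hi h0, (hg.eval_eq_zero_iff hi t).1 h1⟩

theorem exists_cons (hg : IsSignMap s P Q g) (hh : IsSignMap s Q P h) (hR₁ : PolynomialIVT R₁)
    (hR₂ : PolynomialIVT R₂) {i j : ι} (hj : j ∈ s) (hPj : P j = derivative (P i))
    (hQj : Q j = derivative (Q i)) (h0 : P j ≠ 0)
    (hroot : ∀ z ∈ cutSet s P, SignType.sign ((P i).eval z) = SignType.sign ((Q i).eval (g z))) :
    ∃ g', IsSignMap (i ::ₘ s) P Q g' := by
  have hcell := hg.isCellMap hh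
  obtain ⟨g', h1, h2, h3, h4⟩ := hcell.exists_sign_eq hR₁ hR₂ (p := P i) (q := Q i)
    (fun c hc => ⟨j, hj, h0, by rw [hPj, hc]⟩)
    (fun c hc => ⟨j, hj, hg.ne_zero hj h0, by rw [hQj, hc]⟩) hroot
    (fun t => by rw [← hPj, ← hQj]; exact hg.sign_eq j hj t)
  refine ⟨g', h1, fun k hk t => ?_⟩
  rcases Multiset.mem_cons.1 hk with rfl | hk
  · exact h4 t
  rw [hg.sign_eq k hk t]
  by_cases ht : t ∈ cutSet s P
  · rw [h2 t ht]
  by_cases hQ : Q k = 0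
  · simp [hQ]
  · exact (h3 t ht).sign_eval_eq hR₂ fun c hc => ⟨k, hk, hQ, hc⟩

end IsSignMap

end CutSet

section Transfer

open Polynomial

/-- The signs of the elements of the finite set `T` determine the possible signs of the
polynomials of the family `S` at the points of any field with the intermediate value property. -/
def DeterminesSigns.{u, v} {A : Type v} [CommRing A] (S : Multiset A[X]) (T : Finset A) : Prop :=
  ∀ (R₁ R₂ : Type u) [Field R₁] [LinearOrder R₁] [IsStrictOrderedRing R₁]
    [Field R₂] [LinearOrder R₂] [IsStrictOrderedRing R₂],
    PolynomialIVT R₁ → PolynomialIVT R₂ → ∀ (φ₁ : A →+* R₁) (φ₂ : A →+* R₂),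
      (∀ a ∈ T, SignType.sign (φ₁ a) = SignType.sign (φ₂ a)) →
        ∃ g, IsSignMap S (Polynomial.map φ₁) (Polynomial.map φ₂) g

/-- The reduction of `p` modulo its derivative: the leading terms of `d * p` and `X * p'` agree. -/
theorem natDegree_natDegree_mul_sub_X_mul_derivative_lt {A : Type*} [CommRing A] {p : A[X]}
    (hp : 0 < p.natDegree) :
    (C (p.natDegree : A) * p - X * derivative p).natDegree < p.natDegree := by
  refine (Nat.le_sub_one_iff_lt hp).1 (natDegree_le_iff_coeff_eq_zero.2 fun m hm => ?_)
  replace hm : p.natDegree ≤ m := by omega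
  obtain ⟨k, rfl⟩ := Nat.exists_eq_succ_of_ne_zero (hp.trans_le hm).ne'
  rw [Nat.succ_eq_add_one] at hm ⊢
  rw [coeff_sub, coeff_C_mul, coeff_X_mul, coeff_derivative]
  rcases hm.eq_or_lt with hm | hm
  · rw [hm]
    push_cast
    ring
  · simp [coeff_eq_zero_of_natDegree_lt hm]

/-- A multiple of `p` with the leading term cancelled by a multiple of `q`. The second factor
`q.leadingCoeff` makes the multiplier of `p` a square, so that the sign of `p` remains at the roots
of `q`. Only one leading term is removed: the degree need not drop below that of `q`. -/
noncomputable def reduceLead {A : Type*} [CommRing A] (p q : A[X]) : A[X] :=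
  C q.leadingCoeff * q.cancelLeads p

theorem natDegree_reduceLead_lt {A : Type*} [CommRing A] {p q : A[X]}
    (h : q.natDegree ≤ p.natDegree) (hp : 0 < p.natDegree) :
    (reduceLead p q).natDegree < p.natDegree :=
  (natDegree_C_mul_le _ _).trans_lt (natDegree_cancelLeads_lt_of_natDegree_le_natDegree h hp)

theorem sign_eval_reduceLead {A R : Type*} [CommRing A] [Field R] [LinearOrder R]
    [IsStrictOrderedRing R] (φ : A →+* R) {p q : A[X]} (h : q.natDegree ≤ p.natDegree)
    (hq : φ q.leadingCoeff ≠ 0) {z : R} (hz : (q.map φ).eval z = 0) :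
    SignType.sign (((reduceLead p q).map φ).eval z) = SignType.sign ((p.map φ).eval z) := by
  have : ((reduceLead p q).map φ).eval z = φ q.leadingCoeff ^ 2 * (p.map φ).eval z := by
    simp [reduceLead, cancelLeads, hz, Nat.sub_eq_zero_of_le h]
    ring
  rw [this, sign_mul, sign_pos (by positivity), one_mul]

theorem sign_eval_eq_of_eval_derivative_eq_zero {A R : Type*} [CommRing A] [Field R] [LinearOrder R]
    [IsStrictOrderedRing R] (φ : A →+* R) {p : A[X]} (hp : 0 < p.natDegree) {z : R}
    (hz : ((derivative p).map φ).eval z = 0) : SignType.sign ((p.map φ).eval z) =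
      SignType.sign (((C (p.natDegree : A) * p - X * derivative p).map φ).eval z) := by
  have : ((C (p.natDegree : A) * p - X * derivative p).map φ).eval z =
      p.natDegree * (p.map φ).eval z := by
    rw [Polynomial.map_sub, Polynomial.map_mul, Polynomial.map_mul, eval_sub, eval_mul,
      eval_mul, hz]
    simp
  rw [this, sign_mul, sign_pos (Nat.cast_pos.2 hp), one_mul]

theorem exists_determinesSigns_of_natDegree_eq_zero.{u, v} {A : Type v} [CommRing A]
    (S : Multiset A[X]) (hS : ∀ p ∈ S, p.natDegree = 0) : ∃ T, DeterminesSigns.{u, v} S T := by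
  classical
  refine ⟨(S.map fun p => p.coeff 0).toFinset, fun R₁ R₂ _ _ _ _ _ _ _ _ φ₁ φ₂ hφ =>
    ⟨fun _ => 0, monotone_const, fun p hp t => ?_⟩⟩
  rw [eq_C_of_natDegree_eq_zero (hS p hp)]
  simpa using hφ (p.coeff 0) (by simpa using ⟨p, hp, rfl⟩)

/-- The step of the sign table induction, where `p` of maximal degree is replaced by its derivative
and by the reductions of `p` modulo the other polynomials and the derivative. -/
theorem exists_isSignMap_of_reduction {A R₁ R₂ : Type*} [CommRing A]
    [Field R₁] [LinearOrder R₁] [IsStrictOrderedRing R₁]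
    [Field R₂] [LinearOrder R₂] [IsStrictOrderedRing R₂]
    (hR₁ : PolynomialIVT R₁) (hR₂ : PolynomialIVT R₂) (φ₁ : A →+* R₁) (φ₂ : A →+* R₂)
    {s : Multiset A[X]} {p : A[X]} (hp : 0 < p.natDegree)
    (hdeg : ∀ q ∈ s, q.natDegree ≤ p.natDegree)
    (hlead₁ : ∀ q ∈ p ::ₘ s, 0 < q.natDegree → φ₁ q.leadingCoeff ≠ 0)
    (hlead₂ : ∀ q ∈ p ::ₘ s, 0 < q.natDegree → φ₂ q.leadingCoeff ≠ 0)
    {g : R₁ → R₂} {h : R₂ → R₁}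
    (hg : IsSignMap (derivative p ::ₘ s + (C (p.natDegree : A) * p - X * derivative p) ::ₘ
      s.map (reduceLead p)) (Polynomial.map φ₁) (Polynomial.map φ₂) g)
    (hh : IsSignMap (derivative p ::ₘ s + (C (p.natDegree : A) * p - X * derivative p) ::ₘ
      s.map (reduceLead p)) (Polynomial.map φ₂) (Polynomial.map φ₁) h) :
    ∃ g', IsSignMap (p ::ₘ s) (Polynomial.map φ₁) (Polynomial.map φ₂) g' := by
  have hsub : ∀ q ∈ derivative p ::ₘ s, q ∈ derivative p ::ₘ s +
      (C (p.natDegree : A) * p - X * derivative p) ::ₘ s.map (reduceLead p) :=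
    fun q hq => Multiset.mem_add.2 (Or.inl hq)
  have hd : (derivative p).map φ₁ ≠ 0 := by
    intro h0
    have h1 := congrArg (fun r => coeff r (p.natDegree - 1)) h0
    simp only [coeff_map, coeff_derivative, coeff_zero, map_mul, map_add, map_natCast, map_one,
      Nat.sub_add_cancel hp, coeff_natDegree, mul_eq_zero] at h1
    refine h1.elim (hlead₁ p (Multiset.mem_cons_self _ _) hp) fun h2 => ?_
    have h3 : (0 : R₁) < ((p.natDegree - 1 : ℕ) : R₁) + 1 := by positivity
    exact h3.ne' h2
  have hroot : ∀ z ∈ cutSet (derivative p ::ₘ s) (Polynomial.map φ₁),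
      SignType.sign ((p.map φ₁).eval z) = SignType.sign ((p.map φ₂).eval (g z)) := by
    rintro z ⟨q, hq, h0, hz⟩
    have hz₂ := (hg.eval_eq_zero_iff (hsub q hq) z).2 hz
    rcases Multiset.mem_cons.1 hq with rfl | hq
    · rw [sign_eval_eq_of_eval_derivative_eq_zero φ₁ hp hz,
        sign_eval_eq_of_eval_derivative_eq_zero φ₂ hp hz₂]
      exact hg.sign_eq _ (Multiset.mem_add.2 (Or.inr (Multiset.mem_cons_self _ _))) z
    · have hpos : 0 < q.natDegree := by
        rw [Nat.pos_iff_ne_zero]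
        intro h1
        rw [eq_C_of_natDegree_eq_zero h1] at hz h0
        simp only [map_C, eval_C] at hz h0
        exact h0 (by rw [hz, C_0])
      have hq' : q ∈ p ::ₘ s := Multiset.mem_cons_of_mem hq
      rw [← sign_eval_reduceLead φ₁ (hdeg q hq) (hlead₁ q hq' hpos) hz,
        ← sign_eval_reduceLead φ₂ (hdeg q hq) (hlead₂ q hq' hpos) hz₂]
      exact hg.sign_eq _ (Multiset.mem_add.2 (Or.inr (Multiset.mem_cons_of_mem
        (Multiset.mem_map_of_mem _ hq)))) z
  obtain ⟨g', hg'⟩ := (hg.mono hsub).exists_cons (hh.mono hsub) hR₁ hR₂ (i := p)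
    (Multiset.mem_cons_self _ _) (derivative_map _ _).symm (derivative_map _ _).symm hd hroot
  refine ⟨g', hg'.mono fun q hq => ?_⟩
  simp only [Multiset.mem_cons] at hq ⊢
  tauto

/-- Sign tables in one variable, after Cohen and Hörmander: finitely many sign conditions on the
coefficients determine the signs which the polynomials of a finite family can take at a point. -/
theorem exists_determinesSigns.{u, v} {A : Type v} [CommRing A] (S : Multiset A[X]) :
    ∃ T, DeterminesSigns.{u, v} S T := by
  classical
  induction hm : S.map natDegree using
    (WellFounded.cutExpand (r := ((· < ·) : ℕ → ℕ → Prop)) wellFounded_lt).induction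
    generalizing S with
  | _ m ih =>
  -- The multiset of degrees decreases in the hydra order: one degree is replaced by smaller ones.
  by_cases hS : ∀ p ∈ S, p.natDegree = 0
  · exact exists_determinesSigns_of_natDegree_eq_zero S hS
  push Not at hS
  obtain ⟨p₀, hp₀, hp₀'⟩ := hS
  obtain ⟨p, hpS, hmax⟩ := S.toFinset.exists_max_image natDegree ⟨p₀, by simpa using hp₀⟩
  rw [Multiset.mem_toFinset] at hpS
  have hp : 0 < p.natDegree :=
    (Nat.pos_of_ne_zero hp₀').trans_le (hmax p₀ (by simpa using hp₀))
  -- A leading coefficient which vanishes under `φ₁` and `φ₂` is erased.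
  have herase : ∀ q : A[X], ∃ T, q ∈ S → 0 < q.natDegree →
      DeterminesSigns.{u, v} (q.eraseLead ::ₘ S.erase q) T := by
    intro q
    by_cases hq : q ∈ S ∧ 0 < q.natDegree
    · obtain ⟨T, hT⟩ := ih (Multiset.map natDegree (q.eraseLead ::ₘ S.erase q))
        ⟨{q.eraseLead.natDegree}, q.natDegree, by
        simpa using eraseLead_natDegree_lt_or_eraseLead_eq_zero q |>.elim id
          (fun h => by rw [h]; simpa using hq.2), by
        rw [← hm]
        conv_rhs => rw [← Multiset.cons_erase hq.1]
        simp only [Multiset.map_cons]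
        simp only [← Multiset.singleton_add]
        abel⟩ _ rfl
      exact ⟨T, fun _ _ => hT⟩
    · exact ⟨∅, fun h1 h2 => absurd ⟨h1, h2⟩ hq⟩
  choose T hT using herase
  set s := S.erase p
  have hdeg : ∀ q ∈ s, q.natDegree ≤ p.natDegree := fun q hq =>
    hmax q (by simpa using Multiset.mem_of_mem_erase hq)
  obtain ⟨T', hT'⟩ := ih (Multiset.map natDegree (derivative p ::ₘ s +
      (C (p.natDegree : A) * p - X * derivative p) ::ₘ s.map (reduceLead p)))
    ⟨(derivative p ::ₘ (C (p.natDegree : A) * p - X * derivative p) ::ₘ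
      s.map (reduceLead p)).map natDegree, p.natDegree, by
    simp only [Multiset.map_cons, Multiset.mem_cons, Multiset.map_map, Multiset.mem_map]
    rintro d (rfl | rfl | ⟨q, hq, rfl⟩)
    · exact natDegree_derivative_lt hp.ne'
    · exact natDegree_natDegree_mul_sub_X_mul_derivative_lt hp
    · exact natDegree_reduceLead_lt (hdeg q hq) hp, by
    rw [← hm]
    conv_rhs => rw [← Multiset.cons_erase hpS]
    simp only [Multiset.map_cons, Multiset.map_add]
    simp only [← Multiset.singleton_add, s]
    abel⟩ _ rfl
  refine ⟨S.toFinset.biUnion T ∪ T' ∪ S.toFinset.image leadingCoeff,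
    fun R₁ R₂ _ _ _ _ _ _ h₁ h₂ φ₁ φ₂ hφ => ?_⟩
  have hlead : ∀ q ∈ S, (φ₁ q.leadingCoeff = 0 ↔ φ₂ q.leadingCoeff = 0) := by
    intro q hq
    rw [← sign_eq_zero_iff, hφ q.leadingCoeff, sign_eq_zero_iff]
    exact Finset.mem_union_right _ (Finset.mem_image_of_mem _ (by simpa using hq))
  by_cases hq : ∃ q ∈ S, 0 < q.natDegree ∧ φ₁ q.leadingCoeff = 0
  · obtain ⟨q, hqS, hq, hq0⟩ := hq
    obtain ⟨g, hg⟩ := hT q hqS hq R₁ R₂ h₁ h₂ φ₁ φ₂ fun a ha => hφ a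
      (Finset.mem_union_left _ (Finset.mem_union_left _
        (Finset.mem_biUnion.2 ⟨q, by simpa using hqS, ha⟩)))
    have hmap : ∀ {R : Type u} [Field R] (φ : A →+* R), φ q.leadingCoeff = 0 →
        q.map φ = q.eraseLead.map φ := by
      intro R _ φ h0
      conv_lhs => rw [← eraseLead_add_C_mul_X_pow q]
      rw [Polynomial.map_add, Polynomial.map_mul, map_C, h0, C_0, zero_mul, add_zero]
    refine ⟨g, hg.monotone, fun r hr t => ?_⟩
    rw [← Multiset.cons_erase hqS] at hr
    rcases Multiset.mem_cons.1 hr with rfl | hr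
    · rw [hmap φ₁ hq0, hmap φ₂ ((hlead r hqS).1 hq0)]
      exact hg.sign_eq _ (Multiset.mem_cons_self _ _) t
    · exact hg.sign_eq _ (Multiset.mem_cons_of_mem hr) t
  · push Not at hq
    have hφ' : ∀ a ∈ T', SignType.sign (φ₁ a) = SignType.sign (φ₂ a) := fun a ha =>
      hφ a (Finset.mem_union_left _ (Finset.mem_union_right _ ha))
    obtain ⟨g, hg⟩ := hT' R₁ R₂ h₁ h₂ φ₁ φ₂ hφ'
    obtain ⟨h, hh⟩ := hT' R₂ R₁ h₂ h₁ φ₂ φ₁ fun a ha => (hφ' a ha).symm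
    rw [← Multiset.cons_erase hpS]
    rw [← Multiset.cons_erase hpS] at hq hlead
    exact exists_isSignMap_of_reduction h₁ h₂ φ₁ φ₂ hp hdeg hq
      (fun q hqS hpos h0 => hq q hqS hpos ((hlead q hqS).2 h0)) hg hh

/-- Tarski's transfer principle for sign conditions: a finite system of sign conditions which has a
solution in one field with the intermediate value property has one in every other such field in
which the signs of finitely many coefficients are the same. -/
theorem exists_finset_sign_eval₂_eq.{u, v} {A : Type v} [CommRing A] (n : ℕ)
    (S : Finset (MvPolynomial (Fin n) A)) : ∃ T : Finset A,
      ∀ (R₁ R₂ : Type u) [Field R₁] [LinearOrder R₁] [IsStrictOrderedRing R₁]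
        [Field R₂] [LinearOrder R₂] [IsStrictOrderedRing R₂],
        PolynomialIVT R₁ → PolynomialIVT R₂ → ∀ (φ₁ : A →+* R₁) (φ₂ : A →+* R₂),
          (∀ a ∈ T, SignType.sign (φ₁ a) = SignType.sign (φ₂ a)) →
            ∀ x : Fin n → R₁, ∃ z : Fin n → R₂, ∀ p ∈ S,
              SignType.sign (p.eval₂ φ₁ x) = SignType.sign (p.eval₂ φ₂ z) := by
  classical
  induction n with
  | zero =>
    refine ⟨S.image MvPolynomial.constantCoeff,
      fun R₁ R₂ _ _ _ _ _ _ _ _ φ₁ φ₂ hφ x => ⟨Fin.elim0, fun p hp => ?_⟩⟩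
    rw [MvPolynomial.eq_C_of_isEmpty p, MvPolynomial.eval₂_C, MvPolynomial.eval₂_C]
    exact hφ _ (Finset.mem_image_of_mem _ hp)
  | succ n ih =>
    obtain ⟨T, hT⟩ := exists_determinesSigns.{u, v}
      (S.val.map (MvPolynomial.finSuccEquiv A n))
    obtain ⟨T', hT'⟩ := ih T
    refine ⟨T', fun R₁ R₂ _ _ _ _ _ _ h₁ h₂ φ₁ φ₂ hφ x => ?_⟩
    obtain ⟨z, hz⟩ := hT' R₁ R₂ h₁ h₂ φ₁ φ₂ hφ (fun i => x i.succ)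
    obtain ⟨g, hg⟩ := hT R₁ R₂ h₁ h₂ (MvPolynomial.eval₂Hom φ₁ fun i => x i.succ)
      (MvPolynomial.eval₂Hom φ₂ z) hz
    have key : ∀ {R : Type u} [Field R] (φ : A →+* R) (y : Fin (n + 1) → R)
        (p : MvPolynomial (Fin (n + 1)) A), p.eval₂ φ y =
          ((MvPolynomial.finSuccEquiv A n p).map
            (MvPolynomial.eval₂Hom φ fun i => y i.succ)).eval (y 0) := by
      intro R _ φ y p
      induction p using MvPolynomial.induction_on with
      | C a => simp [MvPolynomial.finSuccEquiv_apply]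
      | add p q hp hq => simp [hp, hq]
      | mul_X p i hp =>
        rw [MvPolynomial.eval₂_mul, hp, map_mul, Polynomial.map_mul, eval_mul,
          MvPolynomial.eval₂_X]
        congr 1
        refine Fin.cases ?_ (fun j => ?_) i
        · simp [MvPolynomial.finSuccEquiv_X_zero]
        · simp [MvPolynomial.finSuccEquiv_X_succ]
    refine ⟨Fin.cons (g (x 0)) z, fun p hp => ?_⟩
    rw [key φ₁ x p, key φ₂ _ p]
    exact hg.sign_eq _ (Multiset.mem_map_of_mem _ hp) (x 0)

end Transfer

/-! ### Ordered extensions with the intermediate value property -/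

open Polynomial in
/-- The intermediate value property follows by induction on the degree if each irreducible `p` has a
root or a positive multiple `p * q` with `q` of smaller degree: then `q` changes sign with `p`, but
a root of `q` is impossible. -/
theorem PolynomialIVT.of_irreducible {R : Type*} [Field R] [LinearOrder R] [IsStrictOrderedRing R]
    (H : ∀ p : R[X], Irreducible p → (∃ c, p.IsRoot c) ∨
      ∃ q : R[X], q.natDegree < p.natDegree ∧ ∀ c, 0 < p.eval c * q.eval c) :
    PolynomialIVT R := by
  intro p a b hab hp
  induction hn : p.natDegree using Nat.strong_induction_on generalizing p with
  | _ n ih =>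
  have hp0 : p ≠ 0 := by rintro rfl; simp at hp
  by_cases hirr : Irreducible p
  · rcases H p hirr with ⟨c, hroot⟩ | ⟨q, hqn, hpos⟩
    · -- An irreducible polynomial with a root is linear.
      obtain ⟨q, hq⟩ := dvd_iff_isRoot.2 hroot
      have hq0 : q.natDegree = 0 := by
        have h1 : p.natDegree = 1 :=
          natDegree_eq_of_degree_eq_some (degree_eq_one_of_irreducible_of_root hirr hroot)
        rw [hq, natDegree_mul (X_sub_C_ne_zero _) (by rintro rfl; simp [hq] at hp0),
          natDegree_X_sub_C] at h1
        omega
      rw [eq_C_of_natDegree_eq_zero hq0] at hq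
      rw [hq] at hp
      simp only [eval_mul, eval_sub, eval_X, eval_C] at hp
      have h2 : (a - c) * (b - c) < 0 := by
        by_contra! h2
        nlinarith [mul_nonneg h2 (mul_self_nonneg (q.coeff 0))]
      refine ⟨c, ?_, ?_, hroot⟩
      · by_contra! h3
        nlinarith
      · by_contra! h3
        nlinarith
    · obtain ⟨c, -, -, h6⟩ := ih _ (hn ▸ hqn) q (by
        have h7 := mul_pos (hpos a) (hpos b)
        by_contra! h8
        rw [mul_mul_mul_comm] at h7
        exact absurd h7 (not_lt.2 (mul_nonpos_of_nonpos_of_nonneg hp.le h8))) rfl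
      exact absurd (hpos c) (by simp [h6])
  · have hunit : ¬ IsUnit p := by
      intro h
      obtain ⟨k, -, rfl⟩ := isUnit_iff.1 h
      simp only [eval_C] at hp
      exact absurd hp (not_lt.2 (mul_self_nonneg k))
    rw [irreducible_iff] at hirr
    push Not at hirr
    obtain ⟨q₁, q₂, rfl, h1, h2⟩ := hirr hunit
    have hq₁ := left_ne_zero_of_mul hp0
    have hq₂ := right_ne_zero_of_mul hp0
    have hd₁ : 0 < q₁.natDegree :=
      natDegree_pos_iff_degree_pos.2 (degree_pos_of_ne_zero_of_nonunit hq₁ h1)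
    have hd₂ : 0 < q₂.natDegree :=
      natDegree_pos_iff_degree_pos.2 (degree_pos_of_ne_zero_of_nonunit hq₂ h2)
    rw [natDegree_mul hq₁ hq₂] at hn
    have hprod : (q₁.eval a * q₁.eval b) * (q₂.eval a * q₂.eval b) < 0 := by
      rwa [mul_mul_mul_comm, ← eval_mul, ← eval_mul]
    rcases mul_neg_iff.1 hprod with ⟨-, h3⟩ | ⟨h3, -⟩
    · obtain ⟨c, h4, h5, h6⟩ := ih _ (by omega) q₂ h3 rfl
      exact ⟨c, h4, h5, by simp [h6]⟩
    · obtain ⟨c, h4, h5, h6⟩ := ih _ (by omega) q₁ h3 rfl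
      exact ⟨c, h4, h5, by simp [h6]⟩

open Polynomial in
theorem natDegree_le_of_mem_closure {R : Type*} [Semiring R] {s : Set R[X]} {n : ℕ}
    (hs : ∀ f ∈ s, f.natDegree ≤ n) {h : R[X]} (hh : h ∈ AddSubmonoid.closure s) :
    h.natDegree ≤ n :=
  AddSubmonoid.closure_induction (motive := fun h _ => h.natDegree ≤ n) hs (by simp)
    (fun x y _ _ hx hy => (natDegree_add_le x y).trans (max_le hx hy)) hh

section WeightedSquares

open Polynomial IntermediateField

variable {F Ω : Type*} [Field F] [Field Ω] [Algebra F Ω]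

/-- The sums of squares of elements of `M` with weights from `U`. -/
def weightedSquares (U : Submonoid F) (M : IntermediateField F Ω) : AddSubmonoid Ω :=
  AddSubmonoid.closure {y | ∃ u ∈ U, ∃ x ∈ M, y = algebraMap F Ω u * x ^ 2}

variable {U : Submonoid F} {M : IntermediateField F Ω}

theorem algebraMap_mul_sq_mem_weightedSquares {u : F} (hu : u ∈ U) {x : Ω} (hx : x ∈ M) :
    algebraMap F Ω u * x ^ 2 ∈ weightedSquares U M :=
  AddSubmonoid.subset_closure ⟨u, hu, x, hx, rfl⟩

theorem sq_mem_weightedSquares {x : Ω} (hx : x ∈ M) : x ^ 2 ∈ weightedSquares U M := by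
  simpa using algebraMap_mul_sq_mem_weightedSquares U.one_mem hx

theorem weightedSquares_le : ∀ x ∈ weightedSquares U M, x ∈ M := by
  intro x hx
  refine AddSubmonoid.closure_induction (motive := fun x _ => x ∈ M) ?_ M.zero_mem
    (fun x y _ _ => M.add_mem) hx
  rintro x ⟨u, -, y, hy, rfl⟩
  exact M.mul_mem (M.algebraMap_mem u) (pow_mem hy 2)

theorem mul_mem_weightedSquares {x y : Ω} (hx : x ∈ weightedSquares U M)
    (hy : y ∈ weightedSquares U M) : x * y ∈ weightedSquares U M := by
  refine AddSubmonoid.closure_induction₂ (motive := fun x y _ _ => x * y ∈ weightedSquares U M)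
    ?_ ?_ ?_ ?_ ?_ hx hy
  · rintro x y ⟨u, hu, a, ha, rfl⟩ ⟨v, hv, b, hb, rfl⟩
    have := algebraMap_mul_sq_mem_weightedSquares (U.mul_mem hu hv) (M.mul_mem ha hb)
    rw [map_mul] at this
    convert this using 1
    ring
  · intro x _
    simp
  · intro x _
    simp
  · intro x y z _ _ _ h1 h2
    rw [add_mul]
    exact add_mem h1 h2
  · intro x y z _ _ _ h1 h2
    rw [mul_add]
    exact add_mem h1 h2

theorem eq_zero_of_mem_weightedSquares (hM : (-1 : Ω) ∉ weightedSquares U M) {x : Ω}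
    (hx : x ∈ weightedSquares U M) (hx' : -x ∈ weightedSquares U M) : x = 0 := by
  by_contra h0
  refine hM ?_
  have := mul_mem_weightedSquares (mul_mem_weightedSquares hx hx')
    (sq_mem_weightedSquares (M.inv_mem (weightedSquares_le x hx)))
  convert this using 1
  field_simp

theorem exists_maximal_neg_one_notMem_weightedSquares
    (h : (-1 : Ω) ∉ weightedSquares U (⊥ : IntermediateField F Ω)) :
    ∃ M : IntermediateField F Ω, Maximal (fun M => (-1 : Ω) ∉ weightedSquares U M) M := by
  suffices H : ∀ c ⊆ {M : IntermediateField F Ω | (-1 : Ω) ∉ weightedSquares U M},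
      IsChain (· ≤ ·) c → ∀ y ∈ c, ∃ ub ∈ {M : IntermediateField F Ω |
        (-1 : Ω) ∉ weightedSquares U M}, ∀ z ∈ c, z ≤ ub by
    obtain ⟨M, -, hM⟩ := zorn_le_nonempty₀ _ H ⊥ h
    exact ⟨M, hM⟩
  intro c hc hchain M₀ hM₀
  refine ⟨sSup c, ?_, fun z hz => le_sSup hz⟩
  have hmono : ∀ {M N : IntermediateField F Ω}, M ≤ N →
      weightedSquares U M ≤ weightedSquares U N := by
    intro M N hMN
    refine AddSubmonoid.closure_mono ?_
    rintro x ⟨u, hu, y, hy, rfl⟩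
    exact ⟨u, hu, y, hMN hy, rfl⟩
  have key : ∀ x ∈ weightedSquares U (sSup c), ∃ M ∈ c, x ∈ weightedSquares U M := by
    intro x hx
    refine AddSubmonoid.closure_induction (motive := fun x _ => ∃ M ∈ c, x ∈ weightedSquares U M)
      ?_ ⟨M₀, hM₀, zero_mem _⟩ ?_ hx
    · rintro x ⟨u, hu, y, hy, rfl⟩
      have : Nonempty c := ⟨⟨M₀, hM₀⟩⟩
      have hdir : Directed (· ≤ ·) (fun M : c => (M : IntermediateField F Ω)) :=
        hchain.directed
      rw [sSup_eq_iSup', ← SetLike.mem_coe, IntermediateField.coe_iSup_of_directed hdir,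
        Set.mem_iUnion] at hy
      obtain ⟨M, hM⟩ := hy
      exact ⟨M, M.2, algebraMap_mul_sq_mem_weightedSquares hu hM⟩
    · rintro x y _ _ ⟨M, hM, hx⟩ ⟨N, hN, hy⟩
      rcases hchain.total hM hN with h1 | h1
      · exact ⟨N, hN, add_mem (hmono h1 hx) hy⟩
      · exact ⟨M, hM, add_mem hx (hmono h1 hy)⟩
  intro h1
  obtain ⟨M, hM, h2⟩ := key _ h1
  exact hc hM h2

/-- The weighted sums of squares of polynomials of degree less than `d`. -/
noncomputable def weightedPolynomialSquares (U : Submonoid F) (M : IntermediateField F Ω) (d : ℕ) :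
    AddSubmonoid M[X] :=
  AddSubmonoid.closure {h | ∃ u ∈ U, ∃ f : M[X], f.natDegree < d ∧ h = C (algebraMap F M u) * f ^ 2}

theorem natDegree_le_of_mem_weightedPolynomialSquares {d : ℕ} {h : M[X]}
    (hh : h ∈ weightedPolynomialSquares U M d) : h.natDegree ≤ 2 * (d - 1) := by
  refine natDegree_le_of_mem_closure ?_ hh
  intro k ⟨u, _, f, hf, hk⟩
  have h1 : (f ^ 2).natDegree ≤ 2 * f.natDegree := natDegree_pow_le
  have h2 := natDegree_C_mul_le (algebraMap F M u) (f ^ 2)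
  rw [hk]
  omega

theorem eval_mem_weightedSquares {d : ℕ} {h : M[X]}
    (hh : h ∈ weightedPolynomialSquares U M d) (a : M) :
    ((h.eval a : M) : Ω) ∈ weightedSquares U M := by
  refine AddSubmonoid.closure_induction
    (motive := fun h _ => ((eval a h : M) : Ω) ∈ weightedSquares U M) ?_ (by simp)
    (fun x y _ _ hx hy => by simpa using add_mem hx hy) hh
  rintro _ ⟨u, hu, f, -, rfl⟩
  simpa using algebraMap_mul_sq_mem_weightedSquares hu (f.eval a).2

theorem exists_aeval_eq_of_mem_weightedSquares {r : Ω} (hr : IsIntegral M r) {y : Ω}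
    (hy : y ∈ weightedSquares U (M⟮r⟯.restrictScalars F)) :
    ∃ h ∈ weightedPolynomialSquares U M (minpoly M r).natDegree, aeval r h = y := by
  refine AddSubmonoid.closure_induction
    (motive := fun y _ =>
      ∃ h ∈ weightedPolynomialSquares U M (minpoly M r).natDegree, aeval r h = y)
    ?_ ⟨0, zero_mem _, by simp⟩ ?_ hy
  · rintro _ ⟨u, hu, x, hx, rfl⟩
    rw [IntermediateField.mem_restrictScalars, ← IntermediateField.mem_toSubalgebra,
      IntermediateField.adjoin_simple_toSubalgebra_of_isAlgebraic hr.isAlgebraic,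
      Algebra.adjoin_singleton_eq_range_aeval] at hx
    obtain ⟨f, rfl⟩ := hx
    refine ⟨_, AddSubmonoid.subset_closure ⟨u, hu, f %ₘ minpoly M r,
      natDegree_modByMonic_lt _ (minpoly.monic hr) (minpoly.ne_one M r), rfl⟩, ?_⟩
    have h1 : aeval r (f %ₘ minpoly M r) = aeval r f := by
      conv_rhs => rw [← modByMonic_add_div f (minpoly M r)]
      simp
    rw [map_mul, map_pow, h1, aeval_C, ← IsScalarTower.algebraMap_apply]
    rfl
  · rintro _ _ _ _ ⟨h, hh, rfl⟩ ⟨k, hk, rfl⟩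
    exact ⟨h + k, add_mem hh hk, map_add _ _ _⟩

/-- Adjoining a new element to a maximal field makes `-1` a weighted sum of squares. -/
theorem exists_aeval_eq_neg_one (hM : Maximal (fun M => (-1 : Ω) ∉ weightedSquares U M) M) {r : Ω}
    (hr : IsIntegral M r) (hrM : r ∉ M) :
    ∃ h ∈ weightedPolynomialSquares U M (minpoly M r).natDegree, aeval r h = -1 := by
  refine exists_aeval_eq_of_mem_weightedSquares hr (by_contra fun h => hrM ?_)
  refine hM.2 h (fun x hx => ?_) (IntermediateField.mem_adjoin_simple_self M r)
  exact IntermediateField.algebraMap_mem M⟮r⟯ (⟨x, hx⟩ : M)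

/-- If a square root of `a` cannot be adjoined, then `-1 = s + a * t` with weighted sums of squares
`s` and `t`, so that `-a = (1 + s) / t`. -/
theorem neg_mem_weightedSquares_of_sq_eq
    (hM : Maximal (fun M => (-1 : Ω) ∉ weightedSquares U M) M) {r : Ω} {a : Ω} (ha : a ∈ M)
    (hr : r ^ 2 = a) (hrM : r ∉ M) : -a ∈ weightedSquares U M := by
  have hann : aeval r (X ^ 2 - C (⟨a, ha⟩ : M)) = 0 := by
    simp [hr, IntermediateField.algebraMap_apply]
  have hmonic : (X ^ 2 - C (⟨a, ha⟩ : M)).Monic := monic_X_pow_sub_C _ two_ne_zero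
  have hdeg : (minpoly M r).natDegree ≤ 2 := by
    have := natDegree_le_of_dvd (minpoly.dvd M r hann) hmonic.ne_zero
    rwa [natDegree_X_pow_sub_C] at this
  obtain ⟨h, hh, h1⟩ := exists_aeval_eq_neg_one hM ⟨_, hmonic, by simpa [aeval_def] using hann⟩ hrM
  have key : ∃ s ∈ weightedSquares U M, ∃ t ∈ weightedSquares U M, ∃ v ∈ M,
      aeval r h = s + a * t + v * r := by
    refine AddSubmonoid.closure_induction (motive := fun h _ => ∃ s ∈ weightedSquares U M,
      ∃ t ∈ weightedSquares U M, ∃ v ∈ M, aeval r h = s + a * t + v * r) ?_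
      ⟨0, zero_mem _, 0, zero_mem _, 0, zero_mem _, by simp⟩ ?_ hh
    · rintro _ ⟨u, hu, f, hf, rfl⟩
      obtain ⟨n, m, rfl⟩ := exists_eq_X_add_C_of_natDegree_le_one (show f.natDegree ≤ 1 by omega)
      refine ⟨_, algebraMap_mul_sq_mem_weightedSquares hu m.2, _,
        algebraMap_mul_sq_mem_weightedSquares hu n.2, 2 * algebraMap F Ω u * m * n,
        M.mul_mem (M.mul_mem (M.mul_mem (ofNat_mem M 2) (M.algebraMap_mem u)) m.2) n.2, ?_⟩
      rw [← hr]
      simp only [map_mul, map_pow, map_add, aeval_C, aeval_X, IntermediateField.algebraMap_apply]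
      rw [show ((algebraMap F M u : M) : Ω) = algebraMap F Ω u from rfl]
      ring
    · rintro x y _ _ ⟨s, hs, t, ht, v, hv, h1⟩ ⟨s', hs', t', ht', v', hv', h2⟩
      refine ⟨s + s', add_mem hs hs', t + t', add_mem ht ht', v + v', add_mem hv hv', ?_⟩
      rw [map_add, h1, h2]
      ring
  obtain ⟨s, hs, t, ht, v, hv, h2⟩ := key
  have hv0 : v = 0 := by
    by_contra hv0
    refine hrM ?_
    have h3 : r = v⁻¹ * (-1 - s - a * t) := by
      rw [eq_inv_mul_iff_mul_eq₀ hv0]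
      linear_combination h2.symm.trans h1
    rw [h3]
    exact M.mul_mem (M.inv_mem hv) (M.sub_mem (M.sub_mem (M.neg_mem M.one_mem)
      (weightedSquares_le s hs)) (M.mul_mem ha (weightedSquares_le t ht)))
  rw [hv0, zero_mul, add_zero, h1] at h2
  have ht0 : t ≠ 0 := by
    rintro rfl
    rw [mul_zero, add_zero] at h2
    exact hM.1 (h2 ▸ hs)
  have h3 : -a = (1 ^ 2 + s) * t * t⁻¹ ^ 2 := by
    field_simp
    linear_combination h2
  rw [h3]
  exact mul_mem_weightedSquares (mul_mem_weightedSquares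
    (add_mem (sq_mem_weightedSquares M.one_mem) hs) ht)
    (sq_mem_weightedSquares (M.inv_mem (weightedSquares_le t ht)))

theorem exists_sq_eq_or_neg [IsAlgClosed Ω]
    (hM : Maximal (fun M => (-1 : Ω) ∉ weightedSquares U M) M) {a : Ω}
    (ha : a ∈ M) : (∃ b ∈ M, b ^ 2 = a) ∨ ∃ b ∈ M, b ^ 2 = -a := by
  obtain ⟨r, hr⟩ := IsAlgClosed.exists_pow_nat_eq a two_pos
  obtain ⟨r', hr'⟩ := IsAlgClosed.exists_pow_nat_eq (-a) two_pos
  by_cases h : r ∈ M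
  · exact Or.inl ⟨r, h, hr⟩
  by_cases h' : r' ∈ M
  · exact Or.inr ⟨r', h', hr'⟩
  have h1 := neg_mem_weightedSquares_of_sq_eq hM ha hr h
  have h2 := neg_mem_weightedSquares_of_sq_eq hM (M.neg_mem ha) hr' h'
  rw [neg_neg] at h2
  have h3 := eq_zero_of_mem_weightedSquares hM.1 h2 h1
  rw [h3, sq_eq_zero_iff] at hr
  exact absurd (hr ▸ M.zero_mem) h

/-- The cone of the weighted sums of squares of a maximal field. It is total by
`exists_sq_eq_or_neg`. -/
def weightedSquaresCone (hM : Maximal (fun M => (-1 : Ω) ∉ weightedSquares U M) M) :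
    RingCone M where
  carrier := {a | (a : Ω) ∈ weightedSquares U M}
  mul_mem' {a b} ha hb := show ((a * b : M) : Ω) ∈ _ from mul_mem_weightedSquares ha hb
  one_mem' := show ((1 : M) : Ω) ∈ weightedSquares U M by
    simpa using sq_mem_weightedSquares (U := U) M.one_mem
  add_mem' {a b} ha hb := show ((a + b : M) : Ω) ∈ _ from (weightedSquares U M).add_mem ha hb
  zero_mem' := show ((0 : M) : Ω) ∈ _ from zero_mem (weightedSquares U M)
  eq_zero_of_mem_of_neg_mem' {a} ha ha' :=
    Subtype.ext (eq_zero_of_mem_weightedSquares (x := (a : Ω)) hM.1 ha ha')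

theorem mem_weightedSquaresCone (hM : Maximal (fun M => (-1 : Ω) ∉ weightedSquares U M) M) {a : M} :
    a ∈ weightedSquaresCone hM ↔ (a : Ω) ∈ weightedSquares U M :=
  Iff.rfl

variable [IsAlgClosed Ω] [Algebra.IsAlgebraic F Ω]

/-- A maximal field has the intermediate value property: for an irreducible `p` without a root,
`-1` is a weighted sum of squares modulo `p`, which gives a positive multiple of `p`. -/
theorem polynomialIVT_of_maximal [LinearOrder M] [IsStrictOrderedRing M]
    (hM : Maximal (fun M => (-1 : Ω) ∉ weightedSquares U M) M)
    (hle : ∀ a : M, (a : Ω) ∈ weightedSquares U M → 0 ≤ a) : PolynomialIVT M := by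
  refine PolynomialIVT.of_irreducible fun p hirr => ?_
  have hp0 : p ≠ 0 := hirr.ne_zero
  obtain ⟨r, hr⟩ := IsAlgClosed.exists_aeval_eq_zero Ω p
    fun h => hirr.not_isUnit (isUnit_iff_degree_eq_zero.2 h)
  by_cases hrM : r ∈ M
  · refine Or.inl ⟨⟨r, hrM⟩, ?_⟩
    have h1 := aeval_algebraMap_apply_eq_algebraMap_eval (A := Ω) (⟨r, hrM⟩ : M) p
    rw [IntermediateField.algebraMap_apply, IntermediateField.algebraMap_apply] at h1
    exact Subtype.ext (h1.symm.trans hr)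
  · have hrint : IsIntegral M r :=
      (Algebra.IsAlgebraic.isAlgebraic (R := F) r).isIntegral.tower_top
    obtain ⟨h, hh, h1⟩ := exists_aeval_eq_neg_one hM hrint hrM
    have hmin := minpoly.eq_of_irreducible hirr hr
    have hlc : p.leadingCoeff⁻¹ ≠ 0 := inv_ne_zero (leadingCoeff_ne_zero.2 hp0)
    have hd : (minpoly M r).natDegree = p.natDegree := by
      rw [← hmin, natDegree_mul_C hlc]
    obtain ⟨q, hq⟩ : p ∣ 1 + h := by
      have : minpoly M r ∣ 1 + h := minpoly.dvd M r (by simp [h1])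
      rw [← hmin] at this
      exact (dvd_mul_right p _).trans this
    have hpos : ∀ c, 0 < p.eval c * q.eval c := by
      intro c
      rw [← eval_mul, ← hq, eval_add, eval_one]
      exact add_pos_of_pos_of_nonneg one_pos (hle _ (eval_mem_weightedSquares hh c))
    have hq0 : q ≠ 0 := by
      rintro rfl
      simpa using hpos 0
    refine Or.inr ⟨q, ?_, hpos⟩
    have h2 : (1 + h).natDegree ≤ 2 * (p.natDegree - 1) := by
      refine (natDegree_add_le _ _).trans (max_le (by simp) ?_)
      rw [← hd]
      exact natDegree_le_of_mem_weightedPolynomialSquares hh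
    rw [hq, natDegree_mul hp0 hq0] at h2
    have h3 := hirr.natDegree_pos
    omega

end WeightedSquares

/-- If `-1` is not a sum of squares with weights from `U`, there is an ordered extension field with
the intermediate value property in which the elements of `U` are nonnegative. -/
theorem exists_polynomialIVT_extension.{u} {F : Type u} [Field F] (U : Submonoid F)
    (hU : (-1 : F) ∉ AddSubmonoid.closure {y | ∃ u ∈ U, ∃ x, y = u * x ^ 2}) :
    ∃ (R : Type u) (_ : Field R) (_ : LinearOrder R) (_ : IsStrictOrderedRing R) (φ : F →+* R),
      PolynomialIVT R ∧ ∀ u ∈ U, 0 ≤ φ u := by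
  classical
  have hbot : (-1 : AlgebraicClosure F) ∉
      weightedSquares U (⊥ : IntermediateField F (AlgebraicClosure F)) := by
    intro h
    have key : ∀ y ∈ weightedSquares U (⊥ : IntermediateField F (AlgebraicClosure F)),
        ∃ x ∈ AddSubmonoid.closure {y | ∃ u ∈ U, ∃ x, y = u * x ^ 2},
          algebraMap F (AlgebraicClosure F) x = y := by
      intro y hy
      refine AddSubmonoid.closure_induction (motive := fun y _ =>
        ∃ x ∈ AddSubmonoid.closure {y | ∃ u ∈ U, ∃ x, y = u * x ^ 2},
          algebraMap F (AlgebraicClosure F) x = y) ?_ ⟨0, zero_mem _, map_zero _⟩ ?_ hy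
      · rintro _ ⟨u, hu, x, hx, rfl⟩
        obtain ⟨x, rfl⟩ := IntermediateField.mem_bot.1 hx
        exact ⟨_, AddSubmonoid.subset_closure ⟨u, hu, x, rfl⟩, by simp⟩
      · rintro _ _ _ _ ⟨x, hx, rfl⟩ ⟨y, hy, rfl⟩
        exact ⟨x + y, add_mem hx hy, map_add _ _ _⟩
    obtain ⟨x, hx, h1⟩ := key _ h
    have : x = -1 := (algebraMap F (AlgebraicClosure F)).injective (by simpa using h1)
    exact hU (this ▸ hx)
  obtain ⟨M, hM⟩ := exists_maximal_neg_one_notMem_weightedSquares hbot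
  let cone := weightedSquaresCone hM
  have : HasMemOrNegMem cone := ⟨fun a => by
    rcases exists_sq_eq_or_neg hM a.2 with ⟨b, hb, h⟩ | ⟨b, hb, h⟩
    · exact Or.inl ((mem_weightedSquaresCone hM).2 (h ▸ sq_mem_weightedSquares hb))
    · exact Or.inr ((mem_weightedSquaresCone hM).2 (by
        rw [NegMemClass.coe_neg, ← h]
        exact sq_mem_weightedSquares hb))⟩
  let _ : LinearOrder M := LinearOrder.mkOfAddGroupCone cone
  have : IsOrderedRing M := IsOrderedRing.mkOfCone cone
  have : IsStrictOrderedRing M := IsOrderedRing.toIsStrictOrderedRing M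
  have hle : ∀ a : M, (a : AlgebraicClosure F) ∈ weightedSquares U M → 0 ≤ a := by
    intro a ha
    show a - 0 ∈ cone
    rw [sub_zero]
    exact (mem_weightedSquaresCone hM).2 ha
  refine ⟨M, inferInstance, inferInstance, inferInstance, algebraMap F M,
    polynomialIVT_of_maximal hM hle, fun u hu => hle _ ?_⟩
  simpa using algebraMap_mul_sq_mem_weightedSquares hu M.one_mem

/-! ### Real places and positive units -/

namespace ExtReal

theorem mAdd_coe_coe (r s : ℝ) : mAdd r s = {((r + s : ℝ) : ExtReal)} := rfl

theorem mAdd_coe_infty (r : ℝ) : mAdd r OnePoint.infty = {OnePoint.infty} := rfl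

theorem mMul_coe_coe (r s : ℝ) : mMul r s = {((r * s : ℝ) : ExtReal)} := rfl

theorem mMul_coe_infty (r : ℝ) :
    mMul r OnePoint.infty = if r = 0 then Set.univ else {OnePoint.infty} := rfl

theorem mMul_infty_coe (r : ℝ) :
    mMul OnePoint.infty r = if r = 0 then Set.univ else {OnePoint.infty} := rfl

theorem mMul_infty_infty : mMul OnePoint.infty OnePoint.infty = {OnePoint.infty} := rfl

theorem mAdd_comm (a b : ExtReal) : mAdd a b = mAdd b a := by
  induction a using OnePoint.rec <;> induction b using OnePoint.rec
  · rfl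
  · rfl
  · rfl
  · rw [mAdd_coe_coe, mAdd_coe_coe, add_comm]

theorem mMul_comm (a b : ExtReal) : mMul a b = mMul b a := by
  induction a using OnePoint.rec <;> induction b using OnePoint.rec
  · rfl
  · rfl
  · rfl
  · rw [mMul_coe_coe, mMul_coe_coe, mul_comm]

end ExtReal

namespace IsRPlace

open ExtReal

variable {K : Type*} [Field K] {χ : K → ExtReal} (hχ : IsRPlace χ) {x y : K} {r s : ℝ}

include hχ

theorem map_add_coe (hx : χ x = r) (hy : χ y = s) : χ (x + y) = ((r + s : ℝ) : ExtReal) := by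
  have h := hχ.map_add x y
  rwa [hx, hy, mAdd_coe_coe] at h

theorem map_mul_coe (hx : χ x = r) (hy : χ y = s) : χ (x * y) = ((r * s : ℝ) : ExtReal) := by
  have h := hχ.map_mul x y
  rwa [hx, hy, mMul_coe_coe] at h

theorem map_neg_coe (hx : χ x = r) : χ (-x) = ((-r : ℝ) : ExtReal) := by
  have h := hχ.map_add x (-x)
  rw [add_neg_cancel, hχ.map_zero, hx] at h
  induction hy : χ (-x) using OnePoint.rec with
  | infty =>
    rw [hy, mAdd_coe_infty] at h
    exact absurd h (OnePoint.coe_ne_infty _)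
  | coe t =>
    rw [hy, mAdd_coe_coe, Set.mem_singleton_iff, OnePoint.coe_eq_coe] at h
    rw [OnePoint.coe_eq_coe]
    linarith

theorem map_sub_coe (hx : χ x = r) (hy : χ y = s) : χ (x - y) = ((r - s : ℝ) : ExtReal) := by
  rw [sub_eq_add_neg, sub_eq_add_neg]
  exact hχ.map_add_coe hx (hχ.map_neg_coe hy)

theorem map_inv_of_eq_infty (hx : χ x = OnePoint.infty) : χ x⁻¹ = ((0 : ℝ) : ExtReal) := by
  have h0 : x ≠ 0 := by
    rintro rfl
    rw [hχ.map_zero] at hx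
    exact OnePoint.coe_ne_infty _ hx
  have h := hχ.map_mul x x⁻¹
  rw [mul_inv_cancel₀ h0, hχ.map_one, hx] at h
  induction hy : χ x⁻¹ using OnePoint.rec with
  | infty =>
    rw [hy, mMul_infty_infty] at h
    exact absurd h (OnePoint.coe_ne_infty _)
  | coe t =>
    rw [hy, mMul_infty_coe] at h
    split_ifs at h with ht
    · rw [ht]
    · exact absurd h (OnePoint.coe_ne_infty _)

theorem map_natCast (m : ℕ) : χ m = ((m : ℝ) : ExtReal) := by
  induction m with
  | zero => simpa using hχ.map_zero
  | succ m ih =>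
    rw [Nat.cast_succ, Nat.cast_succ]
    exact hχ.map_add_coe ih hχ.map_one

/-- The positive units of the valuation ring of a real place. -/
def positiveUnits : Submonoid K where
  carrier := {u | ∃ r : ℝ, 0 < r ∧ χ u = r}
  one_mem' := ⟨1, one_pos, hχ.map_one⟩
  mul_mem' := by
    rintro x y ⟨r, hr, hx⟩ ⟨s, hs, hy⟩
    exact ⟨r * s, mul_pos hr hs, hχ.map_mul_coe hx hy⟩

theorem add_mul_sq_mem_positiveUnits (hx : x ∈ hχ.positiveUnits) (hy : y ∈ hχ.positiveUnits)
    {w : K} {c : ℝ} (hw : χ w = c) : x + y * w ^ 2 ∈ hχ.positiveUnits := by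
  obtain ⟨r, hr, hx⟩ := hx
  obtain ⟨s, hs, hy⟩ := hy
  refine ⟨r + s * (c * c), by nlinarith [mul_nonneg hs.le (mul_self_nonneg c)], ?_⟩
  rw [sq]
  exact hχ.map_add_coe hx (hχ.map_mul_coe hy (hχ.map_mul_coe hw hw))

/-- In a sum of squares weighted by positive units the summand of largest absolute value can be
factored out, so that the sum is the square of an element times a positive unit. -/
theorem eq_zero_or_exists_eq_mul_sq
    (hx : x ∈ AddSubmonoid.closure {y | ∃ u ∈ hχ.positiveUnits, ∃ x, y = u * x ^ 2}) :
    x = 0 ∨ ∃ v ∈ hχ.positiveUnits, ∃ m ≠ 0, x = v * m ^ 2 := by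
  refine AddSubmonoid.closure_induction
    (motive := fun x _ => x = 0 ∨ ∃ v ∈ hχ.positiveUnits, ∃ m ≠ 0, x = v * m ^ 2)
    ?_ (Or.inl rfl) ?_ hx
  · rintro _ ⟨u, hu, m, rfl⟩
    by_cases hm : m = 0
    · exact Or.inl (by simp [hm])
    · exact Or.inr ⟨u, hu, m, hm, rfl⟩
  · rintro x y _ _ (rfl | ⟨v, hv, m, hm, rfl⟩) h2
    · rwa [zero_add]
    · rcases h2 with rfl | ⟨v', hv', m', hm', rfl⟩
      · exact Or.inr ⟨v, hv, m, hm, add_zero _⟩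
      · right
        induction hw : χ (m' / m) using OnePoint.rec with
        | infty =>
          have h3 := hχ.map_inv_of_eq_infty hw
          rw [inv_div] at h3
          refine ⟨_, hχ.add_mul_sq_mem_positiveUnits hv' hv h3, m', hm', ?_⟩
          field_simp
          ring
        | coe c =>
          refine ⟨_, hχ.add_mul_sq_mem_positiveUnits hv hv' hw, m, hm, ?_⟩
          field_simp

theorem neg_one_notMem_closure :
    (-1 : K) ∉ AddSubmonoid.closure {y | ∃ u ∈ hχ.positiveUnits, ∃ x, y = u * x ^ 2} := by
  intro h
  rcases hχ.eq_zero_or_exists_eq_mul_sq h with h | ⟨v, ⟨r, hr, hv⟩, m, hm, h⟩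
  · exact neg_ne_zero.2 one_ne_zero h
  · have h1 := hχ.map_neg_coe hχ.map_one
    induction hm' : χ m using OnePoint.rec with
    | infty =>
      have h2 := hχ.map_inv_of_eq_infty hm'
      have h3 : v = -(m⁻¹ * m⁻¹) := by
        field_simp
        linear_combination -h
      have h4 := hχ.map_neg_coe (hχ.map_mul_coe h2 h2)
      rw [← h3, hv, OnePoint.coe_eq_coe] at h4
      linarith
    | coe c =>
      have h2 := hχ.map_mul_coe hv (hχ.map_mul_coe hm' hm')
      rw [← sq, ← h, h1, OnePoint.coe_eq_coe] at h2
      nlinarith [mul_nonneg hr.le (mul_self_nonneg c)]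

end IsRPlace

/-- A real place is compatible with an ordering induced from an ordered extension field with the
intermediate value property. -/
theorem IsRPlace.exists_polynomialIVT_extension.{u} {K : Type u} [Field K] {χ : K → ExtReal}
    (hχ : IsRPlace χ) :
    ∃ (R : Type u) (_ : Field R) (_ : LinearOrder R) (_ : IsStrictOrderedRing R) (φ : K →+* R),
      PolynomialIVT R ∧ ∀ (x : K) (r : ℝ), 0 < r → χ x = r → 0 < φ x := by
  obtain ⟨R, i₁, i₂, i₃, φ, hR, h⟩ :=
    _root_.exists_polynomialIVT_extension hχ.positiveUnits hχ.neg_one_notMem_closure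
  refine ⟨R, i₁, i₂, i₃, φ, hR, fun x r hr hx => (h x ⟨r, hr, hx⟩).lt_of_ne fun h0 => ?_⟩
  have h1 : x = 0 := φ.injective (by rw [← h0, _root_.map_zero])
  rw [h1, hχ.map_zero, OnePoint.coe_eq_coe] at hx
  exact hr.ne hx

/-! ### Closedness of the multivalued operations, and values of rational functions -/

namespace ExtReal

open Filter

theorem eventually_nhds_infty_lt_abs (N : ℝ) :
    ∀ᶠ t : ExtReal in 𝓝 OnePoint.infty, ∀ r : ℝ, t = r → N < |r| := by
  have h : IsCompact (Metric.closedBall (0 : ℝ) N) := isCompact_closedBall 0 N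
  have h1 := OnePoint.hasBasis_nhds_infty.mem_of_mem (i := Metric.closedBall (0 : ℝ) N)
    ⟨Metric.isClosed_closedBall, h⟩
  filter_upwards [h1] with t ht r hr
  subst hr
  rcases ht with ⟨s, hs, hst⟩ | h0
  · rw [OnePoint.coe_eq_coe] at hst
    subst hst
    simpa using hs
  · exact absurd h0 (OnePoint.coe_ne_infty _)

theorem exists_lt_abs_of_mem_nhds_infty {V : Set ExtReal} (hV : V ∈ 𝓝 OnePoint.infty) :
    ∃ N : ℕ, ∀ r : ℝ, (N : ℝ) < |r| → (r : ExtReal) ∈ V := by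
  obtain ⟨s, ⟨-, hs⟩, hsV⟩ := OnePoint.hasBasis_nhds_infty.mem_iff.1 hV
  obtain ⟨R, hR⟩ := hs.isBounded.exists_norm_le
  obtain ⟨N, hN⟩ := exists_nat_gt R
  refine ⟨N, fun r hr => hsV (Or.inl ⟨r, fun hmem => ?_, rfl⟩)⟩
  have := hR r hmem
  rw [Real.norm_eq_abs] at this
  linarith

theorem exists_rat_of_mem_nhds_coe {V : Set ExtReal} {r : ℝ} (hV : V ∈ 𝓝 (r : ExtReal)) :
    ∃ a b : ℚ, (a : ℝ) < r ∧ r < b ∧ ∀ s : ℝ, a < s → s < b → (s : ExtReal) ∈ V := by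
  rw [OnePoint.nhds_coe_eq, Filter.mem_map, mem_nhds_iff_exists_Ioo_subset] at hV
  obtain ⟨l, u, ⟨h1, h2⟩, h3⟩ := hV
  obtain ⟨a, ha, ha'⟩ := exists_rat_btwn h1
  obtain ⟨b, hb, hb'⟩ := exists_rat_btwn h2
  exact ⟨a, b, ha', hb, fun s hs hs' => h3 ⟨ha.trans hs, hs'.trans hb'⟩⟩

section Tendsto

variable {T : Type*} {l : Filter T} {x y z : T → ExtReal} {r : ℝ} {a b c : ExtReal}

theorem eventually_eq_coe_toReal (h : Tendsto x l (𝓝 (r : ExtReal))) :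
    ∀ᶠ t in l, x t = ((x t).toReal : ExtReal) := by
  filter_upwards [h.eventually (isOpen_compl_singleton.mem_nhds (OnePoint.coe_ne_infty r))]
    with t ht
  generalize x t = u at *
  induction u using OnePoint.rec with
  | infty => exact absurd rfl ht
  | coe s => rfl

theorem tendsto_toReal (h : Tendsto x l (𝓝 (r : ExtReal))) :
    Tendsto (fun t => (x t).toReal) l (𝓝 r) :=
  (continuousAt_toReal_coe r).tendsto.comp h

theorem eq_coe_of_tendsto [l.NeBot] {G : T → ℝ} (hz : Tendsto z l (𝓝 c))
    (hG : Tendsto G l (𝓝 r)) (h : ∀ᶠ t in l, z t = (G t : ExtReal)) : c = r :=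
  tendsto_nhds_unique (hz.congr' h)
    ((OnePoint.continuous_coe.tendsto r).comp hG)

/-- If the limits of a summand and of the sum are finite, so is that of the other summand. -/
theorem eq_infty_of_tendsto_mAdd [l.NeBot] (hx : Tendsto x l (𝓝 (r : ExtReal)))
    (hy : Tendsto y l (𝓝 OnePoint.infty)) (hz : Tendsto z l (𝓝 c))
    (h : ∀ᶠ t in l, z t ∈ mAdd (x t) (y t)) : c = OnePoint.infty := by
  induction c using OnePoint.rec with
  | infty => rfl
  | coe w =>
    refine absurd (eq_coe_of_tendsto hy ((tendsto_toReal hz).sub (tendsto_toReal hx)) ?_).symm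
      (OnePoint.coe_ne_infty _)
    filter_upwards [h, eventually_eq_coe_toReal hx, eventually_eq_coe_toReal hz] with t h h1 h2
    generalize (x t).toReal = r' at *
    generalize (z t).toReal = w' at *
    rw [h1, h2] at h
    generalize y t = u at *
    induction u using OnePoint.rec with
    | infty =>
      rw [mAdd_coe_infty] at h
      exact absurd h (OnePoint.coe_ne_infty _)
    | coe s =>
      rw [mAdd_coe_coe, Set.mem_singleton_iff, OnePoint.coe_eq_coe] at h
      rw [h, add_sub_cancel_left]

/-- The multivalued addition has closed graph. -/
theorem mem_mAdd_of_tendsto [l.NeBot] (hx : Tendsto x l (𝓝 a)) (hy : Tendsto y l (𝓝 b))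
    (hz : Tendsto z l (𝓝 c)) (h : ∀ᶠ t in l, z t ∈ mAdd (x t) (y t)) : c ∈ mAdd a b := by
  induction a using OnePoint.rec with
  | infty =>
    induction b using OnePoint.rec with
    | infty => exact Set.mem_univ _
    | coe s =>
      refine eq_infty_of_tendsto_mAdd hy hx hz ?_
      filter_upwards [h] with t h
      rwa [mAdd_comm]
  | coe r =>
    induction b using OnePoint.rec with
    | infty => exact eq_infty_of_tendsto_mAdd hx hy hz h
    | coe s =>
      refine eq_coe_of_tendsto hz ((tendsto_toReal hx).add (tendsto_toReal hy)) ?_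
      filter_upwards [h, eventually_eq_coe_toReal hx, eventually_eq_coe_toReal hy] with t h h1 h2
      rwa [h1, h2, mAdd_coe_coe] at h

theorem eq_infty_of_tendsto_mMul [l.NeBot] (hr : r ≠ 0) (hx : Tendsto x l (𝓝 (r : ExtReal)))
    (hy : Tendsto y l (𝓝 OnePoint.infty)) (hz : Tendsto z l (𝓝 c))
    (h : ∀ᶠ t in l, z t ∈ mMul (x t) (y t)) : c = OnePoint.infty := by
  induction c using OnePoint.rec with
  | infty => rfl
  | coe w =>
    refine absurd (eq_coe_of_tendsto hy ((tendsto_toReal hz).div (tendsto_toReal hx) hr) ?_).symm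
      (OnePoint.coe_ne_infty _)
    filter_upwards [h, eventually_eq_coe_toReal hx, eventually_eq_coe_toReal hz,
      (tendsto_toReal hx).eventually_ne hr] with t h h1 h2 h3
    simp only [Pi.div_apply]
    generalize (x t).toReal = r' at *
    generalize (z t).toReal = w' at *
    rw [h1, h2] at h
    generalize y t = u at *
    induction u using OnePoint.rec with
    | infty =>
      rw [mMul_coe_infty, if_neg h3] at h
      exact absurd h (OnePoint.coe_ne_infty _)
    | coe s =>
      rw [mMul_coe_coe, Set.mem_singleton_iff, OnePoint.coe_eq_coe] at h
      rw [h, mul_div_cancel_left₀ _ h3]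

theorem eq_infty_of_tendsto_mMul_infty [l.NeBot] (hx : Tendsto x l (𝓝 OnePoint.infty))
    (hy : Tendsto y l (𝓝 OnePoint.infty)) (hz : Tendsto z l (𝓝 c))
    (h : ∀ᶠ t in l, z t ∈ mMul (x t) (y t)) : c = OnePoint.infty := by
  induction c using OnePoint.rec with
  | infty => rfl
  | coe w =>
    have h0 : ∀ᶠ t in l, False := by
      filter_upwards [h, hx.eventually (eventually_nhds_infty_lt_abs (|w| + 1)),
        hy.eventually (eventually_nhds_infty_lt_abs 1), eventually_eq_coe_toReal hz,
        (tendsto_toReal hz).abs.eventually_lt_const (lt_add_one |w|)] with t h h1 h2 h3 h4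
      generalize (z t).toReal = w' at *
      rw [h3] at h
      generalize x t = u at *
      generalize y t = v at *
      induction u using OnePoint.rec with
      | infty =>
        induction v using OnePoint.rec with
        | infty =>
          rw [mMul_infty_infty] at h
          exact absurd h (OnePoint.coe_ne_infty _)
        | coe s =>
          have hs : s ≠ 0 := abs_pos.1 (one_pos.trans (h2 s rfl))
          rw [mMul_infty_coe, if_neg hs] at h
          exact absurd h (OnePoint.coe_ne_infty _)
      | coe r =>
        induction v using OnePoint.rec with
        | infty =>
          have hr : r ≠ 0 := abs_pos.1 ((by positivity : (0 : ℝ) < |w| + 1).trans (h1 r rfl))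
          rw [mMul_coe_infty, if_neg hr] at h
          exact absurd h (OnePoint.coe_ne_infty _)
        | coe s =>
          rw [mMul_coe_coe, Set.mem_singleton_iff, OnePoint.coe_eq_coe] at h
          rw [h, abs_mul] at h4
          nlinarith [h1 r rfl, h2 s rfl, abs_nonneg w]
    exact absurd h0 (Filter.eventually_false_iff_eq_bot.not.2 (NeBot.ne ‹_›))

/-- The multivalued multiplication has closed graph. -/
theorem mem_mMul_of_tendsto [l.NeBot] (hx : Tendsto x l (𝓝 a)) (hy : Tendsto y l (𝓝 b))
    (hz : Tendsto z l (𝓝 c)) (h : ∀ᶠ t in l, z t ∈ mMul (x t) (y t)) : c ∈ mMul a b := by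
  induction a using OnePoint.rec with
  | infty =>
    induction b using OnePoint.rec with
    | infty => exact eq_infty_of_tendsto_mMul_infty hx hy hz h
    | coe s =>
      rw [mMul_infty_coe]
      split_ifs with hs
      · exact Set.mem_univ _
      · refine eq_infty_of_tendsto_mMul hs hy hx hz ?_
        filter_upwards [h] with t h
        rwa [mMul_comm]
  | coe r =>
    induction b using OnePoint.rec with
    | infty =>
      rw [mMul_coe_infty]
      split_ifs with hr
      · exact Set.mem_univ _
      · exact eq_infty_of_tendsto_mMul hr hx hy hz h
    | coe s =>
      refine eq_coe_of_tendsto hz ((tendsto_toReal hx).mul (tendsto_toReal hy)) ?_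
      filter_upwards [h, eventually_eq_coe_toReal hx, eventually_eq_coe_toReal hy] with t h h1 h2
      rwa [h1, h2, mMul_coe_coe] at h

end Tendsto

end ExtReal

namespace RealRatFunc

open ExtReal

variable {n : ℕ}

theorem mul_den (f : RealRatFunc n) : f * algebraMap (MvPolynomial (Fin n) ℝ) _ f.den =
    algebraMap (MvPolynomial (Fin n) ℝ) _ f.num :=
  IsFractionRing.num_mul_den_eq_num_iff_eq.2 rfl

theorem num_mul_eq {f : RealRatFunc n} {p q : MvPolynomial (Fin n) ℝ}
    (h : f * algebraMap _ _ q = algebraMap _ _ p) : f.num * q = p * f.den := by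
  apply IsFractionRing.injective (MvPolynomial (Fin n) ℝ) (RealRatFunc n)
  rw [map_mul, map_mul, ← mul_den, ← h]
  ring

/-- The value may be computed from any fraction representing `f`, at the points where neither the
fraction nor the reduced fraction is indeterminate. -/
theorem value_eq {f : RealRatFunc n} {p q : MvPolynomial (Fin n) ℝ}
    (h : f * algebraMap _ _ q = algebraMap _ _ p) {x : Fin n → ℝ}
    (hf : ¬ (MvPolynomial.eval x f.num = 0 ∧ MvPolynomial.eval x f.den = 0))
    (hpq : ¬ (MvPolynomial.eval x p = 0 ∧ MvPolynomial.eval x q = 0)) :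
    f.value x = if MvPolynomial.eval x q = 0 then OnePoint.infty
      else ((MvPolynomial.eval x p / MvPolynomial.eval x q : ℝ) : ExtReal) := by
  have h1 := congrArg (MvPolynomial.eval x) (num_mul_eq h)
  rw [map_mul, map_mul] at h1
  unfold value
  by_cases hq : MvPolynomial.eval x q = 0
  · have hp : MvPolynomial.eval x p ≠ 0 := fun hp => hpq ⟨hp, hq⟩
    rw [hq, mul_zero, eq_comm, mul_eq_zero, or_iff_right hp] at h1
    rw [if_pos h1, if_pos hq]
  · have hd : MvPolynomial.eval x f.den ≠ 0 := by
      intro hd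
      rw [hd, mul_zero, mul_eq_zero, or_iff_left hq] at h1
      exact hf ⟨h1, hd⟩
    rw [if_neg hd, if_neg hq, (div_eq_div_iff hd hq).2 h1]

theorem eval_den_ne_zero {f : RealRatFunc n} {p q : MvPolynomial (Fin n) ℝ}
    (h : f * algebraMap _ _ q = algebraMap _ _ p) {x : Fin n → ℝ}
    (hq : MvPolynomial.eval x q ≠ 0) : MvPolynomial.eval x f.den ≠ 0 := by
  have hdvd : f.den ∣ q :=
    (IsFractionRing.num_den_reduced (MvPolynomial (Fin n) ℝ) f).symm.dvd_of_dvd_mul_left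
      ⟨p, (num_mul_eq h).trans (mul_comm _ _)⟩
  obtain ⟨r, rfl⟩ := hdvd
  rw [map_mul] at hq
  exact left_ne_zero_of_mul hq

theorem value_const (c : ℝ) {x : Fin n → ℝ}
    (hf : ¬ (MvPolynomial.eval x (const c : RealRatFunc n).num = 0 ∧
      MvPolynomial.eval x (const c : RealRatFunc n).den = 0)) :
    (const c : RealRatFunc n).value x = (c : ExtReal) := by
  rw [value_eq (p := MvPolynomial.C c) (q := 1) (by simp [const]) hf (by simp)]
  simp

theorem value_var (i : Fin n) {x : Fin n → ℝ}
    (hf : ¬ (MvPolynomial.eval x (var i : RealRatFunc n).num = 0 ∧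
      MvPolynomial.eval x (var i : RealRatFunc n).den = 0)) :
    (var i : RealRatFunc n).value x = (x i : ExtReal) := by
  rw [value_eq (p := MvPolynomial.X i) (q := 1) (by simp [var]) hf (by simp)]
  simp

theorem value_add_mem {f g : RealRatFunc n} {x : Fin n → ℝ}
    (hf : ¬ (MvPolynomial.eval x f.num = 0 ∧ MvPolynomial.eval x f.den = 0))
    (hg : ¬ (MvPolynomial.eval x g.num = 0 ∧ MvPolynomial.eval x g.den = 0))
    (hfg : ¬ (MvPolynomial.eval x (f + g).num = 0 ∧ MvPolynomial.eval x (f + g).den = 0)) :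
    (f + g).value x ∈ mAdd (f.value x) (g.value x) := by
  have h : (f + g) * algebraMap (MvPolynomial (Fin n) ℝ) _ (f.den * g.den) =
      algebraMap (MvPolynomial (Fin n) ℝ) _ (f.num * g.den + g.num * f.den) := by
    rw [map_add, map_mul, map_mul, map_mul, ← mul_den f, ← mul_den g]
    ring
  by_cases h1 : MvPolynomial.eval x f.den = 0 <;> by_cases h2 : MvPolynomial.eval x g.den = 0
  · simp only [value, h1, h2, if_true]
    exact Set.mem_univ _
  · rw [value_eq h hfg (by simp_all)]
    simp only [value, h1, h2, if_true, if_false, map_mul, zero_mul]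
    rfl
  · rw [value_eq h hfg (by simp_all)]
    simp only [value, h1, h2, if_true, if_false, map_mul, mul_zero]
    rfl
  · rw [value_eq h hfg (by simp_all)]
    simp only [value, h1, h2, if_false, map_mul, map_add, mul_eq_zero, or_self, mAdd_coe_coe,
      Set.mem_singleton_iff, OnePoint.coe_eq_coe]
    field_simp

theorem value_mul_mem {f g : RealRatFunc n} {x : Fin n → ℝ}
    (hf : ¬ (MvPolynomial.eval x f.num = 0 ∧ MvPolynomial.eval x f.den = 0))
    (hg : ¬ (MvPolynomial.eval x g.num = 0 ∧ MvPolynomial.eval x g.den = 0))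
    (hfg : ¬ (MvPolynomial.eval x (f * g).num = 0 ∧ MvPolynomial.eval x (f * g).den = 0)) :
    (f * g).value x ∈ mMul (f.value x) (g.value x) := by
  have h : (f * g) * algebraMap (MvPolynomial (Fin n) ℝ) _ (f.den * g.den) =
      algebraMap (MvPolynomial (Fin n) ℝ) _ (f.num * g.num) := by
    rw [map_mul, map_mul, ← mul_den f, ← mul_den g]
    ring
  by_cases h1 : MvPolynomial.eval x f.den = 0 <;> by_cases h2 : MvPolynomial.eval x g.den = 0
  · rw [value_eq h hfg (by simp_all)]
    simp only [value, h1, h2, if_true, map_mul, mul_zero]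
    rfl
  · have h3 : f.value x = OnePoint.infty := if_pos h1
    have h4 : g.value x = ((MvPolynomial.eval x g.num / MvPolynomial.eval x g.den : ℝ) : ExtReal) :=
      if_neg h2
    rw [h3, h4, mMul_infty_coe]
    split_ifs with h5
    · exact Set.mem_univ _
    · have h6 : MvPolynomial.eval x g.num ≠ 0 := fun h6 => h5 (by rw [h6, zero_div])
      rw [value_eq h hfg (by simp_all), map_mul, h1, zero_mul, if_pos rfl]
      rfl
  · have h3 : g.value x = OnePoint.infty := if_pos h2
    have h4 : f.value x = ((MvPolynomial.eval x f.num / MvPolynomial.eval x f.den : ℝ) : ExtReal) :=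
      if_neg h1
    rw [h3, h4, mMul_coe_infty]
    split_ifs with h5
    · exact Set.mem_univ _
    · have h6 : MvPolynomial.eval x f.num ≠ 0 := fun h6 => h5 (by rw [h6, zero_div])
      rw [value_eq h hfg (by simp_all), map_mul, h2, mul_zero, if_pos rfl]
      rfl
  · rw [value_eq h hfg (by simp_all)]
    simp only [value, h1, h2, if_false, map_mul, mul_eq_zero, or_self, mMul_coe_coe,
      Set.mem_singleton_iff, OnePoint.coe_eq_coe]
    field_simp

end RealRatFunc

/-! ### Points of the graphoid as real places -/

namespace RealRatFunc

open ExtReal Filter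

variable {n : ℕ} {F : Subfield (RealRatFunc n)}

/-- A point of the graphoid is, for each finite subfamily, a limit along a filter of points of `ℝⁿ`
at which no function of the subfamily is indeterminate. -/
theorem exists_filter_of_mem_graphoid {γ : (Fin n → ExtReal) × (F → ExtReal)} (hγ : γ ∈ graphoid F)
    (E : Finset F) (hE : E.Nonempty) :
    ∃ l : Filter (Fin n → ℝ), l.NeBot ∧
      (∀ᶠ x in l, ∀ f ∈ E, ¬ (MvPolynomial.eval x (f : RealRatFunc n).num = 0 ∧
        MvPolynomial.eval x (f : RealRatFunc n).den = 0)) ∧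
      (∀ i, Tendsto (fun x : Fin n → ℝ => (x i : ExtReal)) l (𝓝 (γ.1 i))) ∧
      ∀ f ∈ E, Tendsto (f : RealRatFunc n).value l (𝓝 (γ.2 f)) := by
  let D : Set (Fin n → ℝ) := {x | ∀ f ∈ E, ¬ (MvPolynomial.eval x (f : RealRatFunc n).num = 0 ∧
    MvPolynomial.eval x (f : RealRatFunc n).den = 0)}
  let G : (Fin n → ℝ) → (Fin n → ExtReal) × (E → ExtReal) := fun x =>
    (fun i => (x i : ExtReal), fun f => (f.1 : RealRatFunc n).value x)
  have hmem : (γ.1, fun f : E => γ.2 f) ∈ closure (G '' D) := by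
    refine closure_mono ?_ (hγ E)
    rintro _ ⟨z, hz, rfl⟩
    obtain ⟨f₀, hf₀⟩ := hE
    obtain ⟨x, rfl, -⟩ := hz f₀ hf₀
    refine ⟨x, fun f hf => ?_, rfl⟩
    obtain ⟨x', hx', h⟩ := hz f hf
    have : x = x' := funext fun i => OnePoint.coe_injective (congrFun hx' i)
    rwa [this]
  set p : (Fin n → ExtReal) × (E → ExtReal) := (γ.1, fun f : E => γ.2 f)
  have hl : (𝓟 D ⊓ comap G (𝓝 p)).NeBot := by
    rw [neBot_inf_comap_iff_map, map_principal, inf_comm]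
    exact mem_closure_iff_clusterPt.1 hmem
  have hG : Tendsto G (𝓟 D ⊓ comap G (𝓝 p)) (𝓝 p) := tendsto_comap.mono_left inf_le_right
  refine ⟨_, hl, ?_, fun i => ?_, fun f hf => ?_⟩
  · exact (eventually_principal.2 fun x hx => hx).filter_mono inf_le_left
  · exact ((continuous_apply i).comp continuous_fst).continuousAt.tendsto.comp hG
  · exact ((continuous_apply (⟨f, hf⟩ : E)).comp continuous_snd).continuousAt.tendsto.comp hG

theorem snd_const_of_mem_graphoid {γ : (Fin n → ExtReal) × (F → ExtReal)} (hγ : γ ∈ graphoid F)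
    {c : ℝ} (hc : const c ∈ F) : γ.2 ⟨const c, hc⟩ = (c : ExtReal) := by
  obtain ⟨l, hl, h1, -, h2⟩ := exists_filter_of_mem_graphoid hγ {⟨const c, hc⟩}
    (Finset.singleton_nonempty _)
  refine eq_coe_of_tendsto (h2 _ (Finset.mem_singleton_self _)) tendsto_const_nhds ?_
  filter_upwards [h1] with x hx
  exact value_const c (hx _ (Finset.mem_singleton_self _))

theorem snd_var_of_mem_graphoid {γ : (Fin n → ExtReal) × (F → ExtReal)} (hγ : γ ∈ graphoid F)
    {i : Fin n} (hi : var i ∈ F) : γ.2 ⟨var i, hi⟩ = γ.1 i := by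
  obtain ⟨l, hl, h1, h2, h3⟩ := exists_filter_of_mem_graphoid hγ {⟨var i, hi⟩}
    (Finset.singleton_nonempty _)
  refine tendsto_nhds_unique (h3 _ (Finset.mem_singleton_self _)) ((h2 i).congr' ?_)
  filter_upwards [h1] with x hx
  exact (value_var i (hx _ (Finset.mem_singleton_self _))).symm

theorem isRPlace_of_mem_graphoid {γ : (Fin n → ExtReal) × (F → ExtReal)} (hγ : γ ∈ graphoid F) :
    IsRPlace γ.2 where
  map_zero := by
    have h0 : (const 0 : RealRatFunc n) = 0 := by simp [const]
    have := snd_const_of_mem_graphoid hγ (c := 0) (by rw [h0]; exact F.zero_mem)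
    rwa [show (⟨const 0, _⟩ : F) = 0 from Subtype.ext h0] at this
  map_one := by
    have h1 : (const 1 : RealRatFunc n) = 1 := by simp [const]
    have := snd_const_of_mem_graphoid hγ (c := 1) (by rw [h1]; exact F.one_mem)
    rwa [show (⟨const 1, _⟩ : F) = 1 from Subtype.ext h1] at this
  map_add f g := by
    classical
    obtain ⟨l, hl, h1, -, h2⟩ := exists_filter_of_mem_graphoid hγ {f, g, f + g} (by simp)
    refine mem_mAdd_of_tendsto (h2 f (by simp)) (h2 g (by simp)) (h2 (f + g) (by simp)) ?_
    filter_upwards [h1] with x hx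
    exact value_add_mem (hx f (by simp)) (hx g (by simp)) (hx (f + g) (by simp))
  map_mul f g := by
    classical
    obtain ⟨l, hl, h1, -, h2⟩ := exists_filter_of_mem_graphoid hγ {f, g, f * g} (by simp)
    refine mem_mMul_of_tendsto (h2 f (by simp)) (h2 g (by simp)) (h2 (f * g) (by simp)) ?_
    filter_upwards [h1] with x hx
    exact value_mul_mem (hx f (by simp)) (hx g (by simp)) (hx (f * g) (by simp))

theorem mem_multiExt_of_mem_graphoid {γ : (Fin n → ExtReal) × (F → ExtReal)} (hγ : γ ∈ graphoid F)
    (f : F) : γ.2 f ∈ (toPartialFn (f : RealRatFunc n)).multiExt γ.1 := by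
  have hcont : Continuous fun z : (Fin n → ExtReal) × (({f} : Finset F) → ExtReal) =>
      (z.1, z.2 ⟨f, Finset.mem_singleton_self f⟩) := by fun_prop
  refine map_mem_closure (f := fun z : (Fin n → ExtReal) × (({f} : Finset F) → ExtReal) =>
    (z.1, z.2 ⟨f, Finset.mem_singleton_self f⟩)) hcont (hγ {f}) ?_
  rintro _ ⟨x, hx, rfl⟩
  exact ⟨x, hx f (Finset.mem_singleton_self f), rfl⟩

/-- The real place given by a point of the graphoid. -/
def placeOfGraphoid (F : Subfield (RealRatFunc n)) (γ : graphoid F) : RPlaceSpace F :=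
  ⟨γ.1.2, isRPlace_of_mem_graphoid γ.2⟩

theorem isEmbedding_placeOfGraphoid (hF : ∀ i : Fin n, var i ∈ F) :
    Topology.IsEmbedding (placeOfGraphoid F) := by
  -- The point `a` is recovered from the values at the variables.
  let g : RPlaceSpace F → (Fin n → ExtReal) × (F → ExtReal) := fun χ =>
    (fun i => χ.1 ⟨var i, hF i⟩, χ.1)
  have hg : Continuous g :=
    (continuous_pi fun i => (continuous_apply _).comp continuous_subtype_val).prodMk
      continuous_subtype_val
  have hcont : Continuous (placeOfGraphoid F) := by
    refine Continuous.subtype_mk ?_ _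
    fun_prop
  have hcomp : g ∘ placeOfGraphoid F = Subtype.val := by
    funext γ
    exact Prod.ext (funext fun i => snd_var_of_mem_graphoid γ.2 (hF i)) rfl
  exact Topology.IsEmbedding.of_comp hcont hg (hcomp ▸ Topology.IsEmbedding.subtypeVal)

end RealRatFunc

/-! ### Approximation of real places by points -/

theorem polynomialIVT_real : PolynomialIVT ℝ := by
  intro p a b hab h
  have hcont := p.continuous.continuousOn (s := Set.Icc a b)
  rcases mul_neg_iff.1 h with ⟨h1, h2⟩ | ⟨h1, h2⟩
  · obtain ⟨c, hc, h0⟩ := intermediate_value_Ioo' hab.le hcont ⟨h2, h1⟩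
    exact ⟨c, hc.1, hc.2, h0⟩
  · obtain ⟨c, hc, h0⟩ := intermediate_value_Ioo hab.le hcont ⟨h1, h2⟩
    exact ⟨c, hc.1, hc.2, h0⟩

namespace RealRatFunc

open ExtReal Filter

variable {n : ℕ} (K : Subfield ℝ)

/-- An element of `K(x₁, …, xₙ)` is a fraction of polynomials over `K`, which need not be the
reduced fraction over `ℝ`. -/
theorem exists_fraction {f : RealRatFunc n} (hf : f ∈ overSubfield n K) :
    ∃ p q : MvPolynomial (Fin n) K, q ≠ 0 ∧
      f * algebraMap _ _ (MvPolynomial.map K.subtype q) =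
        algebraMap (MvPolynomial (Fin n) ℝ) (RealRatFunc n) (MvPolynomial.map K.subtype p) := by
  refine Subfield.closure_induction (p := fun f _ => ∃ p q : MvPolynomial (Fin n) K, q ≠ 0 ∧
      f * algebraMap _ _ (MvPolynomial.map K.subtype q) =
        algebraMap (MvPolynomial (Fin n) ℝ) (RealRatFunc n) (MvPolynomial.map K.subtype p))
    ?_ ?_ ?_ ?_ ?_ ?_ hf
  · rintro _ (⟨c, hc, rfl⟩ | ⟨i, rfl⟩)
    · exact ⟨MvPolynomial.C ⟨c, hc⟩, 1, one_ne_zero, by simp [const]⟩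
    · exact ⟨MvPolynomial.X i, 1, one_ne_zero, by simp [var]⟩
  · exact ⟨1, 1, one_ne_zero, by simp⟩
  · rintro f g _ _ ⟨p, q, hq, h⟩ ⟨p', q', hq', h'⟩
    refine ⟨p * q' + p' * q, q * q', mul_ne_zero hq hq', ?_⟩
    simp only [map_mul, map_add, ← h, ← h']
    ring
  · rintro f _ ⟨p, q, hq, h⟩
    refine ⟨-p, q, hq, ?_⟩
    rw [map_neg, map_neg, ← h]
    ring
  · rintro f _ ⟨p, q, hq, h⟩
    by_cases hf0 : f = 0
    · exact ⟨0, 1, one_ne_zero, by simp [hf0]⟩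
    · refine ⟨q, p, ?_, ?_⟩
      · rintro rfl
        rw [map_zero, map_zero, mul_eq_zero, or_iff_right hf0] at h
        refine hq (MvPolynomial.map_injective K.subtype Subtype.val_injective ?_)
        rw [map_zero]
        exact IsFractionRing.injective (MvPolynomial (Fin n) ℝ) (RealRatFunc n)
          (h.trans (map_zero _).symm)
      · rw [← h, inv_mul_cancel_left₀ hf0]
  · rintro f g _ _ ⟨p, q, hq, h⟩ ⟨p', q', hq', h'⟩
    refine ⟨p * p', q * q', mul_ne_zero hq hq', ?_⟩
    simp only [map_mul, ← h, ← h']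
    ring

/-- The inclusion of the polynomials with coefficients in `K` into the field `K(x₁, …, xₙ)`. -/
noncomputable def ofPolynomial : MvPolynomial (Fin n) K →+* overSubfield n K :=
  ((algebraMap (MvPolynomial (Fin n) ℝ) (RealRatFunc n)).comp
    (MvPolynomial.map K.subtype)).codRestrict (overSubfield n K) fun p => by
      induction p using MvPolynomial.induction_on with
      | C c => simpa [const] using const_mem_overSubfield (n := n) c.2
      | add p q hp hq =>
        rw [map_add]
        exact add_mem hp hq
      | mul_X p i hp =>
        rw [map_mul]
        refine mul_mem hp ?_
        have hi : (var i : RealRatFunc n) ∈ overSubfield n K :=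
          Subfield.subset_closure (Or.inr ⟨i, rfl⟩)
        simpa [var] using hi

theorem coe_ofPolynomial (p : MvPolynomial (Fin n) K) : (ofPolynomial K p : RealRatFunc n) =
    algebraMap (MvPolynomial (Fin n) ℝ) (RealRatFunc n) (MvPolynomial.map K.subtype p) := rfl

theorem ofPolynomial_injective : Function.Injective (ofPolynomial (n := n) K) := fun _ _ h =>
  MvPolynomial.map_injective K.subtype Subtype.val_injective
    (IsFractionRing.injective (MvPolynomial (Fin n) ℝ) (RealRatFunc n) (congrArg Subtype.val h))

theorem ofPolynomial_C (c : K) : ofPolynomial K (MvPolynomial.C c) =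
    (⟨const c, const_mem_overSubfield c.2⟩ : overSubfield n K) := by
  apply Subtype.ext
  simp [coe_ofPolynomial, const]

variable {K} {χ : overSubfield n K → ExtReal}

/-- In an ordering compatible with `χ`, the condition that the value of `f` is close to `χ f`
follows from finitely many sign conditions on polynomials which hold at the generic point. -/
theorem exists_finset_sign_imp_value_mem (hχ : IsRPlace χ)
    (hχK : ∀ c : K, χ (ofPolynomial K (MvPolynomial.C c)) = ((c : ℝ) : ExtReal))
    {R : Type*} [Field R] [LinearOrder R] [IsStrictOrderedRing R] {φ : overSubfield n K →+* R}
    (hφ : ∀ (x : overSubfield n K) (r : ℝ), 0 < r → χ x = r → 0 < φ x)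
    (f : overSubfield n K) {V : Set ExtReal}
    (hV : V ∈ 𝓝 (χ f)) : ∃ S : Finset (MvPolynomial (Fin n) K), ∀ z : Fin n → ℝ,
      (∀ p ∈ S, SignType.sign (φ (ofPolynomial K p)) = SignType.sign (p.eval₂ K.subtype z)) →
        MvPolynomial.eval z (f : RealRatFunc n).den ≠ 0 ∧ (f : RealRatFunc n).value z ∈ V := by
  classical
  obtain ⟨p, q, hq, h⟩ := exists_fraction K f.2
  have hfq : f * ofPolynomial K q = ofPolynomial K p := Subtype.ext h
  have hq0 : ofPolynomial K q ≠ 0 :=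
    fun h0 => hq (ofPolynomial_injective K (h0.trans (map_zero _).symm))
  have hφq : φ (ofPolynomial K q) ≠ 0 := (map_ne_zero φ).2 hq0
  have hval : ∀ z, q.eval₂ K.subtype z ≠ 0 → MvPolynomial.eval z (f : RealRatFunc n).den ≠ 0 ∧
      (f : RealRatFunc n).value z =
        ((p.eval₂ K.subtype z / q.eval₂ K.subtype z : ℝ) : ExtReal) := by
    intro z hz
    rw [← MvPolynomial.eval_map] at hz
    have hd := eval_den_ne_zero h hz
    refine ⟨hd, ?_⟩
    rw [value_eq h (fun h0 => hd h0.2) (fun h0 => hz h0.2), if_neg hz, MvPolynomial.eval_map,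
      MvPolynomial.eval_map]
  induction hf : χ f using OnePoint.rec with
  | infty =>
    rw [hf] at hV
    obtain ⟨N, hN⟩ := exists_lt_abs_of_mem_nhds_infty hV
    -- `p² - N² q² = (f q)² (1 - N² / f²)`, and the value of the last factor is `1`.
    refine ⟨{q, p * p - MvPolynomial.C (N : K) * MvPolynomial.C (N : K) * (q * q)},
      fun z hz => ?_⟩
    have hzq := hz q (by simp)
    have hzp := hz _ (Finset.mem_insert_of_mem (Finset.mem_singleton_self _))
    have hz0 : q.eval₂ K.subtype z ≠ 0 := by
      rwa [← sign_ne_zero, ← hzq, sign_ne_zero]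
    obtain ⟨hd, hv⟩ := hval z hz0
    refine ⟨hd, hv ▸ hN _ ?_⟩
    have hf0 : f ≠ 0 := by
      rintro rfl
      rw [hχ.map_zero] at hf
      exact OnePoint.coe_ne_infty _ hf
    have hpos : 0 < φ (ofPolynomial K
        (p * p - MvPolynomial.C (N : K) * MvPolynomial.C (N : K) * (q * q))) := by
      have h1 : ofPolynomial K (p * p - MvPolynomial.C (N : K) * MvPolynomial.C (N : K) * (q * q)) =
          (f * ofPolynomial K q) * (f * ofPolynomial K q) * (1 -
            ofPolynomial K (MvPolynomial.C (N : K)) * ofPolynomial K (MvPolynomial.C (N : K)) *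
              (f⁻¹ * f⁻¹)) := by
        simp only [map_sub, map_mul, ← hfq]
        field_simp
      have h2 := hχ.map_inv_of_eq_infty hf
      have h3 := hχ.map_sub_coe hχ.map_one (hχ.map_mul_coe (hχ.map_mul_coe (hχK N) (hχK N))
        (hχ.map_mul_coe h2 h2))
      rw [h1, map_mul, map_mul]
      refine mul_pos (mul_self_pos.2 ((map_ne_zero φ).2 (mul_ne_zero hf0 hq0)))
        (hφ _ _ ?_ h3)
      norm_num
    rw [sign_pos hpos, eq_comm, sign_eq_one_iff] at hzp
    simp only [MvPolynomial.eval₂_sub, MvPolynomial.eval₂_mul, MvPolynomial.eval₂_C] at hzp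
    rw [map_natCast] at hzp
    rw [abs_div, lt_div_iff₀ (abs_pos.2 hz0)]
    refine lt_of_pow_lt_pow_left₀ 2 (abs_nonneg _) ?_
    rw [mul_pow, sq_abs, sq_abs]
    linarith
  | coe r =>
    rw [hf] at hV
    obtain ⟨a, b, ha, hb, hab⟩ := exists_rat_of_mem_nhds_coe hV
    -- `q (p - a q) = q² (f - a)`, and the value of `f - a` is `r - a > 0`; similarly for `b`.
    refine ⟨{q, q * (p - MvPolynomial.C (a : K) * q), q * (MvPolynomial.C (b : K) * q - p)},
      fun z hz => ?_⟩
    have hzq := hz q (by simp)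
    have hza := hz (q * (p - MvPolynomial.C (a : K) * q)) (by simp)
    have hzb := hz (q * (MvPolynomial.C (b : K) * q - p)) (by simp)
    have hz0 : q.eval₂ K.subtype z ≠ 0 := by
      rwa [← sign_ne_zero, ← hzq, sign_ne_zero]
    obtain ⟨hd, hv⟩ := hval z hz0
    have h1 : ofPolynomial K (q * (p - MvPolynomial.C (a : K) * q)) =
        ofPolynomial K q * ofPolynomial K q * (f - ofPolynomial K (MvPolynomial.C (a : K))) := by
      simp only [map_sub, map_mul, ← hfq]
      ring
    have h2 : ofPolynomial K (q * (MvPolynomial.C (b : K) * q - p)) =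
        ofPolynomial K q * ofPolynomial K q * (ofPolynomial K (MvPolynomial.C (b : K)) - f) := by
      simp only [map_sub, map_mul, ← hfq]
      ring
    have h3 := hφ _ _ (by simpa using ha) (hχ.map_sub_coe hf (hχK a))
    have h4 := hφ _ _ (by simpa using hb) (hχ.map_sub_coe (hχK b) hf)
    have hposa := mul_pos (mul_self_pos.2 hφq) h3
    rw [← map_mul, ← map_mul, ← h1] at hposa
    rw [sign_pos hposa, eq_comm, sign_eq_one_iff] at hza
    have hposb := mul_pos (mul_self_pos.2 hφq) h4
    rw [← map_mul, ← map_mul, ← h2] at hposb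
    rw [sign_pos hposb, eq_comm, sign_eq_one_iff] at hzb
    simp only [MvPolynomial.eval₂_sub, MvPolynomial.eval₂_mul, MvPolynomial.eval₂_C] at hza hzb
    rw [map_ratCast] at hza hzb
    generalize MvPolynomial.eval₂ K.subtype z p = P at *
    generalize MvPolynomial.eval₂ K.subtype z q = Q at *
    have hQ : 0 < Q * Q := mul_self_pos.2 hz0
    refine ⟨hd, hv ▸ hab _ ?_ ?_⟩
    · rw [← mul_div_mul_right P Q hz0, lt_div_iff₀ hQ]
      linarith
    · rw [← mul_div_mul_right P Q hz0, div_lt_iff₀ hQ]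
      linarith

/-- A real place fixing the constants is approximated on finite sets by evaluations at points:
the sign conditions of `exists_finset_sign_imp_value_mem` hold at the generic point over an ordered
extension of `K(x₁, …, xₙ)`, and are transferred to `ℝ`. -/
theorem exists_forall_value_mem (hχ : IsRPlace χ)
    (hχK : ∀ c : K, χ (ofPolynomial K (MvPolynomial.C c)) = ((c : ℝ) : ExtReal))
    (E : Finset (overSubfield n K))
    (V : overSubfield n K → Set ExtReal) (hV : ∀ f, V f ∈ 𝓝 (χ f)) :
    ∃ z : Fin n → ℝ, ∀ f ∈ E, MvPolynomial.eval z (f : RealRatFunc n).den ≠ 0 ∧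
      (f : RealRatFunc n).value z ∈ V f := by
  classical
  obtain ⟨R, _, _, _, φ, hR, hφ⟩ := hχ.exists_polynomialIVT_extension
  choose S hS using fun f => exists_finset_sign_imp_value_mem hχ hχK hφ f (hV f)
  obtain ⟨T, hT⟩ := exists_finset_sign_eval₂_eq.{0, 0} n (E.biUnion S)
  have hsign : ∀ c : K, SignType.sign ((φ.comp ((ofPolynomial (n := n) K).comp MvPolynomial.C)) c) =
      SignType.sign (K.subtype c) := by
    intro c
    rcases lt_trichotomy (c : ℝ) 0 with h | h | h
    · have h1 := hφ _ _ (neg_pos.2 h) (hχ.map_neg_coe (hχK c))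
      rw [map_neg, neg_pos] at h1
      exact (sign_neg h1).trans (sign_neg h).symm
    · have h1 : c = 0 := Subtype.ext h
      simp [h1]
    · exact (sign_pos (hφ _ _ h (hχK c))).trans (sign_pos h).symm
  obtain ⟨z, hz⟩ := hT R ℝ hR polynomialIVT_real _ K.subtype (fun c _ => hsign c)
    fun i => φ (ofPolynomial K (MvPolynomial.X i))
  refine ⟨z, fun f hf => hS f z fun p hp => ?_⟩
  rw [← hz p (Finset.mem_biUnion.2 ⟨f, hf, hp⟩)]
  congr 1
  have : φ.comp (ofPolynomial K) = MvPolynomial.eval₂Hom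
      (φ.comp ((ofPolynomial (n := n) K).comp MvPolynomial.C))
      (fun i => φ (ofPolynomial K (MvPolynomial.X i))) := by
    apply MvPolynomial.ringHom_ext <;> simp
  exact congrArg (fun ψ : MvPolynomial (Fin n) K →+* R => ψ p) this

/-- The first components of the point are the values at the variables, so these are approximated
together with the values at the given finite set. -/
theorem mem_graphoid_of_isRPlace (hχ : IsRPlace χ)
    (hχK : ∀ c : K, χ (ofPolynomial K (MvPolynomial.C c)) = ((c : ℝ) : ExtReal))
    (hvar : ∀ i : Fin n, var i ∈ overSubfield n K) :
    ((fun i => χ ⟨var i, hvar i⟩, χ) : (Fin n → ExtReal) × (overSubfield n K → ExtReal)) ∈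
      graphoid (overSubfield n K) := by
  classical
  intro E
  refine mem_closure_iff_nhds.2 fun W hW => ?_
  obtain ⟨A, hA, B, hB, hAB⟩ := mem_nhds_prod_iff.1 hW
  rw [nhds_pi, Filter.mem_pi] at hA hB
  obtain ⟨I, -, a, ha, hIA⟩ := hA
  obtain ⟨J, -, b, hb, hJB⟩ := hB
  obtain ⟨z, hz⟩ := exists_forall_value_mem hχ hχK
    (E ∪ Finset.univ.image fun i => ⟨var i, hvar i⟩)
    (fun f => {y | (∀ i, f = ⟨var i, hvar i⟩ → y ∈ a i) ∧ ∀ h : f ∈ E, y ∈ b ⟨f, h⟩}) (by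
      intro f
      refine Filter.inter_mem (Filter.eventually_all.2 fun i => ?_) ?_
      · by_cases hi : f = ⟨var i, hvar i⟩
        · subst hi
          filter_upwards [ha i] with y hy _ using hy
        · exact Filter.Eventually.of_forall fun y h => absurd h hi
      · by_cases h : f ∈ E
        · filter_upwards [hb ⟨f, h⟩] with y hy _ using hy
        · exact Filter.Eventually.of_forall fun y h' => absurd h' h)
  have hdom : ∀ f ∈ E, (fun i => (z i : ExtReal)) ∈ (toPartialFn (f : RealRatFunc n)).dom :=
    fun f hf => ⟨z, rfl, fun h => (hz f (Finset.mem_union_left _ hf)).1 h.2⟩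
  refine ⟨(fun i => (z i : ExtReal), fun f => (f.1 : RealRatFunc n).value z), hAB ⟨hIA ?_, hJB ?_⟩,
    _, hdom, rfl⟩
  · intro i _
    have h1 := hz ⟨var i, hvar i⟩ (Finset.mem_union_right _
      (Finset.mem_image_of_mem _ (Finset.mem_univ i)))
    rw [value_var i (fun h => h1.1 h.2)] at h1
    exact h1.2.1 i rfl
  · intro f _
    exact (hz f (Finset.mem_union_left _ f.2)).2.2 f.2

end RealRatFunc

theorem theorem3p2 (n : ℕ) (F : Subfield (RealRatFunc n))
    (hF : RealRatFunc.overSubfield n ratSubfield ≤ F) :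
    ∃ δ : RealRatFunc.graphoid F → RPlaceSpace F,
      (∀ (γ : RealRatFunc.graphoid F) (f : F), (δ γ).1 f = γ.1.2 f) ∧
      (∀ (γ : RealRatFunc.graphoid F) (f : F),
        (δ γ).1 f ∈ (RealRatFunc.toPartialFn (f : RealRatFunc n)).multiExt γ.1.1) ∧
      Topology.IsEmbedding δ ∧
      (∀ (K : Subfield ℝ) (hK : F = RealRatFunc.overSubfield n K),
        Set.range δ = {χ : RPlaceSpace F | ∀ (c : ℝ) (hc : c ∈ K),
          χ.1 ⟨RealRatFunc.const c, hK ▸ RealRatFunc.const_mem_overSubfield hc⟩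
            = (c : ExtReal)}) := by
  have hvar : ∀ i : Fin n, RealRatFunc.var i ∈ F :=
    fun i => hF (Subfield.subset_closure (Or.inr ⟨i, rfl⟩))
  refine ⟨RealRatFunc.placeOfGraphoid F, fun _ _ => rfl,
    fun γ f => RealRatFunc.mem_multiExt_of_mem_graphoid γ.2 f,
    RealRatFunc.isEmbedding_placeOfGraphoid hvar, ?_⟩
  rintro K rfl
  ext χ
  constructor
  · rintro ⟨γ, rfl⟩ c hc
    exact RealRatFunc.snd_const_of_mem_graphoid γ.2 _
  · intro hχ
    refine ⟨⟨_, RealRatFunc.mem_graphoid_of_isRPlace χ.2 (fun c => ?_) hvar⟩, rfl⟩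
    rw [RealRatFunc.ofPolynomial_C]
    exact hχ c c.2
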